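/- Let $\mathcal H_\infty$ on $L^2(0,\infty)$ and $\mathcal H_1$ on $L^2(0,1)$ be the bounded Hardy operators $f\mapsto\frac1x\int_0^x f(t)\,dt$, with Hilbert space adjoints $\mathcal H_\infty^*$ and $\mathcal H_1^*$, and regard $L^2(0,1)$ as a subspace of $L^2(0,\infty)$ by extending functions by zero. Let $L^2(i\mathbb R)$ be the $L^2$ space of the imaginary axis with respect to the measure $d\beta$ at the point $i\beta$, let $\phi(s)=\frac{s-\frac12}{s+\frac12}$, and let $M_\phi g=\phi g$ on $L^2(i\mathbb R)$. Let $H^2_+(i\mathbb R)\subset L^2(i\mathbb R)$ be the space of boundary functions $F(i\beta)=\lim_{x\to0^+}F(x+i\beta)$ (for almost every $\beta$) of the analytic functions $F$ on $\{\operatorname{Re}z>0\}$ with $\sup_{x>0}\int_{-\infty}^\infty|F(x+iy)|^2\,dy<\infty$. The modified Mellin transform $$(\mathcal Qf)(i\beta)=\frac1{\sqrt{2\pi}}\int_0^\infty f(t)\,t^{i\beta-\frac12}\,dt,$$ understood as the limit in $L^2(i\mathbb R)$, as $R\to\infty$, of the integrals over $[1/R,R]$, is a well-defined isometric isomorphism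 from $L^2(0,\infty)$ onto $L^2(i\mathbb R)$, and the following hold. 1. $\mathcal Q(I-\mathcal H_\infty^*)=M_\phi\mathcal Q$ on $L^2(0,\infty)$; in particular $I-\mathcal H_\infty^*$ on $L^2(0,\infty)$ is unitarily equivalent to $M_\phi$ on $L^2(i\mathbb R)$. 2. $L^2(0,1)$ is invariant under $I-\mathcal H_\infty^*$, with $(I-\mathcal H_\infty^*)|_{L^2(0,1)}=I-\mathcal H_1^*$; $H^2_+(i\mathbb R)$ is invariant under $M_\phi$; and $\mathcal Q$ restricts to an isometric isomorphism from $L^2(0,1)$ onto $H^2_+(i\mathbb R)$ with $\mathcal Q(I-\mathcal H_1^*)f=M_\phi\mathcal Qf$ for all $f\in L^2(0,1)$. In particular $I-\mathcal H_1^*$ on $L^2(0,1)$ is unitarily equivalent to $M_\phi$ on $H^2_+(i\mathbb R)$. 3. The map $V:L^2(0,\infty)\to L^2(i\mathbb R)$, $(Vf)(i\beta)=(\mathcal Qf)(-i\beta)$, is an isometric isomorphism with $V(I-\mathcal H_\infty)=M_\phi V$; in particular $I-\mathcal H_\infty$ on $L^2(0,\infty)$ is unitarily equivalent to $M_\phi$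 on $L^2(i\mathbb R)$. -/

import Mathlib

open MeasureTheory Set Filter Topology
open scoped ENNReal

noncomputable section

namespace HardyMellin

/-! ### The Hardy operators -/

/-- Hardy's inequality, in the form that makes the Hardy operators bounded on `L²`. -/
theorem hardy_lintegral (g : ℝ → ℝ≥0∞) (hg : Measurable g) :
    ∫⁻ x in Ioi (0 : ℝ), (ENNReal.ofReal x⁻¹ * ∫⁻ t in Ioc 0 x, g t) ^ 2
      ≤ 4 * ∫⁻ t in Ioi (0 : ℝ), g t ^ 2 := by
  have hw : Measurable fun t : ℝ => ENNReal.ofReal (t ^ (1 / 2 : ℝ)) * g t ^ 2 := by fun_prop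
  have cs : ∀ x ∈ Ioi (0 : ℝ), (ENNReal.ofReal x⁻¹ * ∫⁻ t in Ioc 0 x, g t) ^ 2 ≤
      ∫⁻ t in Ioi (0 : ℝ), (Iic x).indicator
        (fun t => ENNReal.ofReal (2 * x ^ (-3 / 2 : ℝ)) *
          (ENNReal.ofReal (t ^ (1 / 2 : ℝ)) * g t ^ 2)) t := by
    intro x hx
    have hx : 0 < x := hx
    have h1 : (∫⁻ t in Ioc 0 x, g t) =
        ∫⁻ t in Ioc 0 x, ((fun t : ℝ => ENNReal.ofReal (t ^ (-1 / 4 : ℝ))) *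
          (fun t : ℝ => ENNReal.ofReal (t ^ (1 / 4 : ℝ)) * g t)) t := by
      refine setLIntegral_congr_fun measurableSet_Ioc fun t ht => ?_
      have ht0 : 0 < t := ht.1
      simp only [Pi.mul_apply]
      rw [← mul_assoc, ← ENNReal.ofReal_mul (by positivity), ← Real.rpow_add ht0]
      norm_num
    have h2 := ENNReal.lintegral_mul_le_Lp_mul_Lq (volume.restrict (Ioc 0 x))
      Real.HolderConjugate.two_two
      (f := fun t : ℝ => ENNReal.ofReal (t ^ (-1 / 4 : ℝ)))
      (g := fun t : ℝ => ENNReal.ofReal (t ^ (1 / 4 : ℝ)) * g t) (by fun_prop) (by fun_prop)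
    have hA : ∫⁻ t in Ioc 0 x, (ENNReal.ofReal (t ^ (-1 / 4 : ℝ))) ^ (2 : ℝ) =
        ENNReal.ofReal (2 * x ^ (1 / 2 : ℝ)) := by
      have : ∫⁻ t in Ioc 0 x, (ENNReal.ofReal (t ^ (-1 / 4 : ℝ))) ^ (2 : ℝ) =
          ∫⁻ t in Ioc 0 x, ENNReal.ofReal (t ^ (-1 / 2 : ℝ)) := by
        refine setLIntegral_congr_fun measurableSet_Ioc fun t ht => ?_
        have ht0 : 0 < t := ht.1
        rw [ENNReal.ofReal_rpow_of_nonneg (by positivity) (by norm_num), ← Real.rpow_mul ht0.le]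
        norm_num
      rw [this, ← ofReal_integral_eq_lintegral_ofReal]
      · rw [← intervalIntegral.integral_of_le hx.le, integral_rpow (by norm_num)]
        congr 1
        norm_num
        ring
      · rw [← IntegrableOn, ← intervalIntegrable_iff_integrableOn_Ioc_of_le hx.le]
        exact intervalIntegral.intervalIntegrable_rpow' (by norm_num)
      · filter_upwards [ae_restrict_mem measurableSet_Ioc] with t ht
        exact Real.rpow_nonneg ht.1.le _
    have hB : ∫⁻ t in Ioc 0 x, (ENNReal.ofReal (t ^ (1 / 4 : ℝ)) * g t) ^ (2 : ℝ) =
        ∫⁻ t in Ioc 0 x, ENNReal.ofReal (t ^ (1 / 2 : ℝ)) * g t ^ 2 := by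
      refine setLIntegral_congr_fun measurableSet_Ioc fun t ht => ?_
      have ht0 : 0 < t := ht.1
      rw [ENNReal.mul_rpow_of_nonneg _ _ (by norm_num),
        ENNReal.ofReal_rpow_of_nonneg (by positivity) (by norm_num), ← Real.rpow_mul ht0.le]
      norm_num
    rw [hA, hB, ← h1] at h2
    have h3 : (∫⁻ t in Ioc 0 x, g t) ^ 2 ≤ ENNReal.ofReal (2 * x ^ (1 / 2 : ℝ)) *
        ∫⁻ t in Ioc 0 x, ENNReal.ofReal (t ^ (1 / 2 : ℝ)) * g t ^ 2 := by
      refine (pow_le_pow_left' h2 2).trans_eq ?_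
      rw [mul_pow, ← ENNReal.rpow_natCast, ← ENNReal.rpow_natCast, ← ENNReal.rpow_mul,
        ← ENNReal.rpow_mul]
      norm_num
    rw [setLIntegral_indicator measurableSet_Iic, inter_comm, Ioi_inter_Iic,
      lintegral_const_mul _ hw, mul_pow]
    refine (mul_le_mul_right h3 _).trans_eq ?_
    rw [← mul_assoc, ← ENNReal.ofReal_pow (by positivity), ← ENNReal.ofReal_mul (by positivity)]
    congr 2
    have : x ^ (-3 / 2 : ℝ) = x⁻¹ ^ 2 * x ^ (1 / 2 : ℝ) := by
      rw [← Real.rpow_neg_one, ← Real.rpow_natCast, ← Real.rpow_mul hx.le, ← Real.rpow_add hx]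
      norm_num
    rw [this]; ring
  have hmeas : Measurable (Function.uncurry fun (x t : ℝ) => (Iic x).indicator
        (fun t => ENNReal.ofReal (2 * x ^ (-3 / 2 : ℝ)) *
          (ENNReal.ofReal (t ^ (1 / 2 : ℝ)) * g t ^ 2)) t) := by
    have : (Function.uncurry fun (x t : ℝ) => (Iic x).indicator
        (fun t => ENNReal.ofReal (2 * x ^ (-3 / 2 : ℝ)) *
          (ENNReal.ofReal (t ^ (1 / 2 : ℝ)) * g t ^ 2)) t) =
        {p : ℝ × ℝ | p.2 ≤ p.1}.indicator fun p =>
          ENNReal.ofReal (2 * p.1 ^ (-3 / 2 : ℝ)) *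
          (ENNReal.ofReal (p.2 ^ (1 / 2 : ℝ)) * g p.2 ^ 2) := by
      ext ⟨x, t⟩
      simp [Function.uncurry, indicator]
    rw [this]
    refine Measurable.indicator (by fun_prop) (measurableSet_le measurable_snd measurable_fst)
  refine (setLIntegral_mono' measurableSet_Ioi cs).trans ?_
  rw [lintegral_lintegral_swap hmeas.aemeasurable, ← lintegral_const_mul _ (by fun_prop)]
  refine setLIntegral_mono' measurableSet_Ioi fun t ht => ?_
  have ht : 0 < t := ht
  have e1 : ∀ x : ℝ, (Iic x).indicator (fun t => ENNReal.ofReal (2 * x ^ (-3 / 2 : ℝ)) *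
          (ENNReal.ofReal (t ^ (1 / 2 : ℝ)) * g t ^ 2)) t =
      (Ici t).indicator (fun x => ENNReal.ofReal (2 * x ^ (-3 / 2 : ℝ)) *
          (ENNReal.ofReal (t ^ (1 / 2 : ℝ)) * g t ^ 2)) x := by
    intro x; simp [indicator]
  simp_rw [e1]
  rw [setLIntegral_indicator measurableSet_Ici, inter_eq_left.2 (Ici_subset_Ioi.2 ht),
    lintegral_mul_const _ (by fun_prop), setLIntegral_congr Ioi_ae_eq_Ici.symm,
    ← ofReal_integral_eq_lintegral_ofReal, integral_const_mul,
    integral_Ioi_rpow_of_lt (by norm_num) ht, ← mul_assoc, ← ENNReal.ofReal_mul]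
  · have : 2 * (-t ^ (-3 / 2 + 1 : ℝ) / (-3 / 2 + 1)) * t ^ (1 / 2 : ℝ) = 4 := by
      have : t ^ (-3 / 2 + 1 : ℝ) * t ^ (1 / 2 : ℝ) = 1 := by
        rw [← Real.rpow_add ht]; norm_num
      linear_combination 4 * this
    rw [this]; simp
  · have := Real.rpow_nonneg ht.le (-3 / 2 + 1 : ℝ)
    have e : 2 * (-t ^ (-3 / 2 + 1 : ℝ) / (-3 / 2 + 1)) = 4 * t ^ (-3 / 2 + 1 : ℝ) := by ring
    rw [e]; positivity
  · exact (integrableOn_Ioi_rpow_of_lt (by norm_num) ht).const_mul _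
  · filter_upwards [ae_restrict_mem measurableSet_Ioi] with x hx
    have : 0 < x := ht.trans hx
    positivity

/-- The two cases of interest are `S = (0, 1)` and `S = (0, ∞)`. -/
structure IsInitial (S : Set ℝ) : Prop where
  meas : MeasurableSet S
  pos : S ⊆ Ioi 0
  initial : ∀ x ∈ S, Ioc 0 x ⊆ S

theorem isInitial_Ioi : IsInitial (Ioi 0) :=
  ⟨measurableSet_Ioi, subset_rfl, fun _ _ _ ht => ht.1⟩

theorem isInitial_Ioo : IsInitial (Ioo 0 1) :=
  ⟨measurableSet_Ioo, fun _ h => h.1, fun _ hx _ ht => ⟨ht.1, ht.2.trans_lt hx.2⟩⟩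

theorem intervalIntegrable_of_memLp {S : Set ℝ} (hS : IsInitial S) {f : ℝ → ℂ}
    (hf : MemLp f 2 (volume.restrict S)) {x : ℝ} (hx : x ∈ S) :
    IntervalIntegrable f volume 0 x := by
  have hx0 : 0 < x := hS.pos hx
  rw [intervalIntegrable_iff_integrableOn_Ioc_of_le hx0.le]
  have : MemLp f 2 (volume.restrict (Ioc 0 x)) :=
    hf.mono_measure (Measure.restrict_mono_set _ (hS.initial x hx))
  exact this.integrable (by norm_num)

/-- The average `x ↦ (1/x) ∫₀ˣ f(t) dt`. -/
def average (f : ℝ → ℂ) (x : ℝ) : ℂ := (x : ℂ)⁻¹ * ∫ t in (0 : ℝ)..x, f t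

theorem average_congr {S : Set ℝ} (hS : IsInitial S) {f g : ℝ → ℂ}
    (h : f =ᵐ[volume.restrict S] g) {x : ℝ} (hx : x ∈ S) : average f x = average g x := by
  have hx0 : 0 < x := hS.pos hx
  unfold average
  rw [intervalIntegral.integral_of_le hx0.le, intervalIntegral.integral_of_le hx0.le,
    integral_congr_ae (ae_mono (Measure.restrict_mono_set _ (hS.initial x hx)) h)]

theorem average_bound {S : Set ℝ} (hS : IsInitial S) {f : ℝ → ℂ}
    (hf : StronglyMeasurable f) :
    AEStronglyMeasurable (average f) (volume.restrict S) ∧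
    eLpNorm (average f) 2 (volume.restrict S) ≤ 2 * eLpNorm f 2 (volume.restrict S) := by
  constructor
  · have h : StronglyMeasurable fun x : ℝ => (x : ℂ)⁻¹ * ∫ t,
        ({p : ℝ × ℝ | 0 < p.2 ∧ p.2 ≤ p.1}.indicator fun p => f p.2) (x, t) := by
      refine StronglyMeasurable.mul
        (Complex.measurable_ofReal.inv.stronglyMeasurable) ?_
      refine StronglyMeasurable.integral_prod_right' ?_
      exact (hf.comp_measurable measurable_snd).indicator
        ((measurableSet_lt measurable_const measurable_snd).inter
          (measurableSet_le measurable_snd measurable_fst))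
    refine h.aestronglyMeasurable.congr ?_
    filter_upwards [ae_restrict_mem hS.meas] with x hx
    have hx0 : 0 < x := hS.pos hx
    unfold average
    rw [intervalIntegral.integral_of_le hx0.le, ← integral_indicator measurableSet_Ioc]
    rfl
  · have key := hardy_lintegral (S.indicator fun t => ‖f t‖ₑ) (hf.enorm.indicator hS.meas)
    have r : ∫⁻ t in Ioi (0 : ℝ), (S.indicator (fun t => ‖f t‖ₑ) t) ^ 2 =
        ∫⁻ t in S, ‖f t‖ₑ ^ 2 := by
      have : (fun t => (S.indicator (fun t => ‖f t‖ₑ) t) ^ 2) =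
          S.indicator (fun t => ‖f t‖ₑ ^ 2) := by
        ext t; by_cases h : t ∈ S <;> simp [h]
      rw [this, setLIntegral_indicator hS.meas, inter_eq_left.2 hS.pos]
    have l : ∫⁻ x in S, ‖average f x‖ₑ ^ 2 ≤ ∫⁻ x in Ioi (0 : ℝ),
        (ENNReal.ofReal x⁻¹ * ∫⁻ t in Ioc 0 x, S.indicator (fun t => ‖f t‖ₑ) t) ^ 2 := by
      refine le_trans ?_ (lintegral_mono_set hS.pos)
      refine setLIntegral_mono' hS.meas fun x hx => ?_
      have hx0 : 0 < x := hS.pos hx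
      gcongr
      have e : ∫⁻ t in Ioc 0 x, S.indicator (fun t => ‖f t‖ₑ) t = ∫⁻ t in Ioc 0 x, ‖f t‖ₑ :=
        setLIntegral_congr_fun measurableSet_Ioc fun t ht => by
          simp [hS.initial x hx ht]
      rw [e, average, intervalIntegral.integral_of_le hx0.le, enorm_mul]
      gcongr
      · rw [← Complex.ofReal_inv, ← ofReal_norm, Complex.norm_real,
          Real.norm_of_nonneg (by positivity)]
      · exact enorm_integral_le_lintegral_enorm _
    rw [r] at key
    have key := l.trans key
    rw [eLpNorm_eq_lintegral_rpow_enorm_toReal (by norm_num) (by norm_num),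
      eLpNorm_eq_lintegral_rpow_enorm_toReal (by norm_num) (by norm_num)]
    simp only [ENNReal.toReal_ofNat, ENNReal.rpow_ofNat]
    refine (ENNReal.rpow_le_rpow key (by norm_num)).trans_eq ?_
    rw [ENNReal.mul_rpow_of_nonneg _ _ (by norm_num)]
    congr 1
    rw [show (4 : ℝ≥0∞) = 2 ^ (2 : ℝ) by norm_num, ← ENNReal.rpow_mul]
    norm_num

theorem memLp_average {S : Set ℝ} (hS : IsInitial S) (f : Lp ℂ 2 (volume.restrict S)) :
    MemLp (average f) 2 (volume.restrict S) := by
  obtain ⟨h1, h2⟩ := average_bound hS (Lp.stronglyMeasurable f)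
  exact ⟨h1, h2.trans_lt (ENNReal.mul_lt_top (by norm_num) (Lp.memLp f).2)⟩

/-- The operator `(H f)(x) = (1/x) ∫₀ˣ f(t) dt` on `L²(S)`. -/
def hardy (S : Set ℝ) (hS : IsInitial S) :
    Lp ℂ 2 (volume.restrict S) →L[ℂ] Lp ℂ 2 (volume.restrict S) :=
  LinearMap.mkContinuous
    { toFun := fun f => (memLp_average hS f).toLp (average f)
      map_add' := fun f g => by
        rw [← MemLp.toLp_add]
        refine MemLp.toLp_congr _ _ ?_
        filter_upwards [ae_restrict_mem hS.meas] with x hx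
        rw [average_congr hS (Lp.coeFn_add f g) hx]
        simp only [average, Pi.add_apply]
        rw [intervalIntegral.integral_add (intervalIntegrable_of_memLp hS (Lp.memLp f) hx)
          (intervalIntegrable_of_memLp hS (Lp.memLp g) hx), mul_add]
      map_smul' := fun c f => by
        rw [RingHom.id_apply, ← MemLp.toLp_const_smul]
        refine MemLp.toLp_congr _ _ ?_
        filter_upwards [ae_restrict_mem hS.meas] with x hx
        rw [average_congr hS (Lp.coeFn_smul c f) hx]
        simp only [average, Pi.smul_apply, smul_eq_mul]
        rw [intervalIntegral.integral_const_mul]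
        ring }
    2 (fun f => by
      simp only [LinearMap.coe_mk, AddHom.coe_mk]
      rw [Lp.norm_toLp, Lp.norm_def, ← ENNReal.toReal_ofNat 2, ← ENNReal.toReal_mul]
      exact ENNReal.toReal_mono (ENNReal.mul_lt_top (by norm_num) (Lp.memLp f).2).ne
        (average_bound hS (Lp.stronglyMeasurable f)).2)

/-- `L²(0, ∞)`. -/
abbrev L2Inf : Type := Lp ℂ 2 (volume.restrict (Ioi (0 : ℝ)))

/-- `L²(0, 1)`. -/
abbrev L2One : Type := Lp ℂ 2 (volume.restrict (Ioo (0 : ℝ) 1))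

/-- The infinite Hardy operator on `L²(0, ∞)`. -/
def hardyInf : L2Inf →L[ℂ] L2Inf := hardy (Ioi 0) isInitial_Ioi

/-- The finite Hardy operator on `L²(0, 1)`. -/
def hardyOne : L2One →L[ℂ] L2One := hardy (Ioo 0 1) isInitial_Ioo

theorem eLpNorm_extend (f : ℝ → ℂ) :
    eLpNorm ((Ioo (0 : ℝ) 1).indicator f) 2 (volume.restrict (Ioi (0 : ℝ))) =
      eLpNorm f 2 (volume.restrict (Ioo (0 : ℝ) 1)) := by
  rw [eLpNorm_indicator_eq_eLpNorm_restrict measurableSet_Ioo,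
    Measure.restrict_restrict measurableSet_Ioo, inter_eq_left.2 (fun _ h => h.1)]

theorem memLp_extend (f : L2One) :
    MemLp ((Ioo (0 : ℝ) 1).indicator f) 2 (volume.restrict (Ioi (0 : ℝ))) :=
  ⟨((Lp.stronglyMeasurable f).indicator measurableSet_Ioo).aestronglyMeasurable,
    (eLpNorm_extend f).trans_lt (Lp.memLp f).2⟩

theorem extend_congr {f g : ℝ → ℂ} (h : f =ᵐ[volume.restrict (Ioo (0 : ℝ) 1)] g) :
    (Ioo (0 : ℝ) 1).indicator f =ᵐ[volume.restrict (Ioi (0 : ℝ))] (Ioo (0 : ℝ) 1).indicator g := by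
  refine ae_restrict_of_ae ?_
  filter_upwards [(ae_restrict_iff' measurableSet_Ioo).1 h] with x hx
  by_cases hm : x ∈ Ioo (0 : ℝ) 1
  · simp [hm, hx hm]
  · simp [hm]

/-- The inclusion of `L²(0, 1)` in `L²(0, ∞)`: extension by zero. -/
def extendZero : L2One →ₗᵢ[ℂ] L2Inf where
  toFun f := (memLp_extend f).toLp _
  map_add' f g := by
    rw [← MemLp.toLp_add]
    refine MemLp.toLp_congr _ _ ((extend_congr (Lp.coeFn_add f g)).trans ?_)
    rw [indicator_add']
  map_smul' c f := by
    rw [RingHom.id_apply, ← MemLp.toLp_const_smul]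
    refine MemLp.toLp_congr _ _ ((extend_congr (Lp.coeFn_smul c f)).trans ?_)
    exact Eventually.of_forall fun x => by by_cases h : x ∈ Ioo (0 : ℝ) 1 <;> simp [indicator, h]
  norm_map' f := by
    simp only [LinearMap.coe_mk, AddHom.coe_mk]
    rw [Lp.norm_toLp, eLpNorm_extend, Lp.norm_def]

/-! ### The imaginary axis -/

/-- Lebesgue measure `dβ` on the imaginary axis `{iβ : β ∈ ℝ}`, as a measure on `ℂ`. -/
def imagAxis : Measure ℂ := Measure.map (fun β : ℝ => (β : ℂ) * Complex.I) volume

/-- `L²(iℝ)`. -/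
abbrev L2Imag : Type := Lp ℂ 2 imagAxis

/-- `f ∈ L²(0, ∞)` has modified Mellin transform `g ∈ L²(iℝ)`, that is
`g(s) = (2π)^{-1/2} ∫₀^∞ f(t) t^{s - 1/2} dt` for `s ∈ iℝ`. For general `f ∈ L²(0, ∞)` the
integral does not converge absolutely; as usual for Fourier-type integrals on `L²`, it is the
`L²(iℝ)`-limit of the integrals over `[1/R, R]` as `R → ∞`. -/
def IsMellinTransform (f : L2Inf) (g : L2Imag) : Prop :=
  Tendsto (fun R : ℝ => eLpNorm (fun s : ℂ => g s -
      ((Real.sqrt (2 * Real.pi) : ℝ) : ℂ)⁻¹ *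
        ∫ t in R⁻¹..R, f t * (t : ℂ) ^ (s - 1 / 2)) 2 imagAxis)
    atTop (𝓝 0)

/-- `φ(s) = (s - 1/2) / (s + 1/2)`. -/
def phi (s : ℂ) : ℂ := (s - 1 / 2) / (s + 1 / 2)

theorem measurable_phi : Measurable phi := by
  unfold phi; fun_prop

theorem norm_phi (β : ℝ) : ‖phi ((β : ℂ) * Complex.I)‖ = 1 := by
  have h : ‖(β : ℂ) * Complex.I - 1 / 2‖ = ‖(β : ℂ) * Complex.I + 1 / 2‖ := by
    rw [Complex.norm_def, Complex.norm_def]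
    congr 1
    simp [Complex.normSq_apply]
  have h0 : (β : ℂ) * Complex.I + 1 / 2 ≠ 0 := fun h => by
    have := congrArg Complex.re h
    simp at this
  rw [phi, norm_div, h, div_self (norm_ne_zero_iff.2 h0)]

theorem memLp_phi : MemLp phi ∞ imagAxis := by
  refine memLp_top_of_bound measurable_phi.aestronglyMeasurable 1 ?_
  rw [imagAxis, ae_map_iff (by fun_prop) (measurableSet_le measurable_phi.norm measurable_const)]
  exact Eventually.of_forall fun β => (norm_phi β).le

/-- The multiplication operator `M_φ g = φ g` on `L²(iℝ)`. -/
def mulPhi : L2Imag →L[ℂ] L2Imag :=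
  (ContinuousLinearMap.mul ℂ ℂ).holderL imagAxis ∞ 2 2 (memLp_phi.toLp phi)

/-- `F` belongs to the Hardy space `H²` of the right half plane `{Re z > 0}`. -/
def IsHardyFunction (F : ℂ → ℂ) : Prop :=
  DifferentiableOn ℂ F {z : ℂ | 0 < z.re} ∧
    (⨆ (x : ℝ) (_ : 0 < x), ∫⁻ y : ℝ, ‖F ((x : ℂ) + (y : ℂ) * Complex.I)‖ₑ ^ 2) < ∞

theorem IsHardyFunction.add {F G : ℂ → ℂ} (hF : IsHardyFunction F) (hG : IsHardyFunction G) :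
    IsHardyFunction (F + G) := by
  refine ⟨hF.1.add hG.1, ?_⟩
  refine lt_of_le_of_lt ?_ (ENNReal.add_lt_top.2
    ⟨ENNReal.mul_lt_top (by norm_num : (2 : ℝ≥0∞) < ∞) hF.2,
      ENNReal.mul_lt_top (by norm_num : (2 : ℝ≥0∞) < ∞) hG.2⟩)
  refine iSup₂_le fun x hx => ?_
  have hm : Measurable fun y : ℝ => ‖F ((x : ℂ) + (y : ℂ) * Complex.I)‖ₑ ^ 2 := by
    have : Continuous fun y : ℝ => F ((x : ℂ) + (y : ℂ) * Complex.I) :=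
      hF.1.continuousOn.comp_continuous (by fun_prop) (fun y => by simpa using hx)
    exact (this.measurable.enorm).pow_const 2
  calc ∫⁻ y : ℝ, ‖(F + G) ((x : ℂ) + (y : ℂ) * Complex.I)‖ₑ ^ 2
      ≤ ∫⁻ y : ℝ, (2 * ‖F ((x : ℂ) + (y : ℂ) * Complex.I)‖ₑ ^ 2 +
          2 * ‖G ((x : ℂ) + (y : ℂ) * Complex.I)‖ₑ ^ 2) := by
        refine lintegral_mono fun y => ?_
        refine (pow_le_pow_left' (enorm_add_le _ _) 2).trans ?_
        have := ENNReal.rpow_add_le_mul_rpow_add_rpow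
          ‖F ((x : ℂ) + (y : ℂ) * Complex.I)‖ₑ ‖G ((x : ℂ) + (y : ℂ) * Complex.I)‖ₑ
          (p := 2) (by norm_num)
        norm_num at this
        rwa [mul_add] at this
    _ = 2 * (∫⁻ y : ℝ, ‖F ((x : ℂ) + (y : ℂ) * Complex.I)‖ₑ ^ 2) +
          2 * ∫⁻ y : ℝ, ‖G ((x : ℂ) + (y : ℂ) * Complex.I)‖ₑ ^ 2 := by
        rw [lintegral_add_left (hm.const_mul 2), lintegral_const_mul' _ _ (by norm_num),
          lintegral_const_mul' _ _ (by norm_num)]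
    _ ≤ _ := by
        gcongr
        · exact le_iSup₂ (f := fun (x : ℝ) (_ : 0 < x) =>
            ∫⁻ y : ℝ, ‖F ((x : ℂ) + (y : ℂ) * Complex.I)‖ₑ ^ 2) x hx
        · exact le_iSup₂ (f := fun (x : ℝ) (_ : 0 < x) =>
            ∫⁻ y : ℝ, ‖G ((x : ℂ) + (y : ℂ) * Complex.I)‖ₑ ^ 2) x hx

theorem IsHardyFunction.smul {F : ℂ → ℂ} (c : ℂ) (hF : IsHardyFunction F) :
    IsHardyFunction (c • F) := by
  refine ⟨hF.1.const_smul c, ?_⟩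
  refine lt_of_le_of_lt ?_ (ENNReal.mul_lt_top
    (ENNReal.pow_lt_top (enorm_lt_top : ‖c‖ₑ < ∞) : ‖c‖ₑ ^ 2 < ∞) hF.2)
  refine iSup₂_le fun x hx => ?_
  simp only [Pi.smul_apply, smul_eq_mul, enorm_mul, mul_pow]
  rw [lintegral_const_mul' _ _ (ENNReal.pow_lt_top enorm_lt_top).ne]
  gcongr
  exact le_iSup₂ (f := fun (x : ℝ) (_ : 0 < x) =>
    ∫⁻ y : ℝ, ‖F ((x : ℂ) + (y : ℂ) * Complex.I)‖ₑ ^ 2) x hx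

/-- `H²₊(iℝ)`: the `g ∈ L²(iℝ)` that are the boundary functions
`g(s) = lim_{x → 0⁺} F(x + s)`, for almost every `s ∈ iℝ`, of some `F` in the Hardy space of the
right half plane. -/
def hardyPlus : Submodule ℂ L2Imag where
  carrier := {g | ∃ F : ℂ → ℂ, IsHardyFunction F ∧
    ∀ᵐ s ∂imagAxis, Tendsto (fun x : ℝ => F ((x : ℂ) + s)) (𝓝[>] 0) (𝓝 (g s))}
  zero_mem' := by
    refine ⟨0, ⟨differentiableOn_const 0, by simp⟩, ?_⟩
    filter_upwards [Lp.coeFn_zero ℂ 2 imagAxis] with s hs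
    rw [hs]
    exact tendsto_const_nhds
  add_mem' := by
    rintro f g ⟨F, hF, hf⟩ ⟨G, hG, hg⟩
    refine ⟨F + G, hF.add hG, ?_⟩
    filter_upwards [Lp.coeFn_add f g, hf, hg] with s hs h1 h2
    rw [hs]
    exact h1.add h2
  smul_mem' := by
    rintro c f ⟨F, hF, hf⟩
    refine ⟨c • F, hF.smul c, ?_⟩
    filter_upwards [Lp.coeFn_smul c f, hf] with s hs h1
    rw [hs]
    exact h1.const_smul c

end HardyMellin

end

/-! The substitution `t = e^{-2πu}` turns the modified Mellin transform into the Fourier transform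
of the line, so it is unitary by Plancherel. The indicator functions `χ` of the intervals `(0, c]`
span a dense subspace, and `(I - H) χ` is a multiple of the power `t⁻¹` truncated to `(c, ∞)`; their
transforms are explicit, which gives the intertwining with `I - H` and, by taking adjoints, the one
with `I - H*`.

For `f` on `(0, 1)` the transform extends analytically to the right half plane, and its restriction
to the line `Re z = x` is the transform of `t ^ x f`, so the extension is a Hardy function. It is
the Poisson integral of its boundary values, hence converges to them almost everywhere. Conversely,
a boundary function `F` is orthogonal to the transforms of the powers `t⁻¹` truncated to `(c, ∞)`,
`c ≥ 1`: the integral of `F` against the conjugate of such a transform can be moved along vertical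
lines to infinity, where it vanishes. So its preimage vanishes almost everywhere on `(1, ∞)`. -/

open scoped FourierTransform

noncomputable section

namespace HardyMellin

theorem fourier_toLp_ae_eq {V E : Type*} [NormedAddCommGroup V] [InnerProductSpace ℝ V]
    [FiniteDimensional ℝ V] [MeasurableSpace V] [BorelSpace V] [NormedAddCommGroup E]
    [InnerProductSpace ℂ E] [CompleteSpace E] {h : V → E} (h1 : Integrable h) (h2 : MemLp h 2) :
    (𝓕 (h2.toLp h) : Lp E 2 (volume : Measure V)) =ᵐ[volume] 𝓕 h := by
  have hcont : Continuous (𝓕 h) :=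
    VectorFourier.fourierIntegral_continuous Real.continuous_fourierChar continuous_inner h1
  refine ae_eq_of_integral_contDiff_smul_eq
    ((Lp.memLp _).locallyIntegrable one_le_two) hcont.locallyIntegrable fun g hg hgs => ?_
  have hgs' : HasCompactSupport fun x => (g x : ℂ) :=
    hgs.comp_left (g := fun x : ℝ => (x : ℂ)) Complex.ofReal_zero
  set G := hgs'.toSchwartzMap (Complex.ofRealCLM.contDiff.comp hg)
  have hG (x : V) (e : E) : g x • e = G x • e := (Complex.coe_smul (g x) e).symm
  have key := DFunLike.congr_fun (Lp.fourier_toTemperedDistribution_eq (h2.toLp h)) G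
  rw [TemperedDistribution.fourier_apply, Lp.toTemperedDistribution_apply,
    Lp.toTemperedDistribution_apply] at key
  calc ∫ x, g x • (𝓕 (h2.toLp h) : Lp E 2 (volume : Measure V)) x
      = ∫ x, (𝓕 G) x • (h2.toLp h) x := by simp_rw [hG, key]
    _ = ∫ x, 𝓕 (fun x => G x) x • h x :=
        integral_congr_ae (by filter_upwards [h2.coeFn_toLp] with x hx; rw [hx]; rfl)
    _ = ∫ x, G x • 𝓕 h x := by
        have := VectorFourier.integral_fourierIntegral_smul_eq_flip (μ := (volume : Measure V))
          (L := innerₗ V) Real.continuous_fourierChar continuous_inner G.integrable h1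
        rwa [flip_innerₗ] at this
    _ = ∫ x, g x • 𝓕 h x := by simp_rw [hG]

theorem eLpNorm_two_eq_lintegral {α E : Type*} [MeasurableSpace α] [NormedAddCommGroup E]
    (μ : Measure α) (f : α → E) : eLpNorm f 2 μ = (∫⁻ a, ‖f a‖ₑ ^ 2 ∂μ) ^ (1 / 2 : ℝ) := by
  simp [eLpNorm_eq_lintegral_rpow_enorm_toReal two_ne_zero ENNReal.ofNat_ne_top]

/-! ### The modified Mellin transform as a unitary operator -/

/-- The substitution `t = e^{-2πu}` of the positive axis by the line. With this normalization
the Mellin variable `iβ` becomes the frequency `β` of Mathlib's Fourier transform. -/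
def expSub (u : ℝ) : ℝ := Real.exp (-(2 * Real.pi * u))

theorem expSub_pos (u : ℝ) : 0 < expSub u := Real.exp_pos _

@[fun_prop]
theorem continuous_expSub : Continuous expSub := by unfold expSub; fun_prop

/-- The inverse of the substitution `expSub`. -/
def logSub (t : ℝ) : ℝ := -Real.log t / (2 * Real.pi)

@[fun_prop]
theorem measurable_logSub : Measurable logSub := by unfold logSub; fun_prop

theorem logSub_expSub (u : ℝ) : logSub (expSub u) = u := by
  rw [logSub, expSub, Real.log_exp]
  field_simp

theorem expSub_logSub {t : ℝ} (ht : 0 < t) : expSub (logSub t) = t := by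
  rw [expSub, logSub, mul_div_cancel₀ _ (by positivity), neg_neg, Real.exp_log ht]

theorem expSub_image_univ : expSub '' univ = Ioi 0 := by
  ext t
  simp only [image_univ, mem_range, mem_Ioi]
  exact ⟨fun ⟨u, hu⟩ => hu ▸ expSub_pos u, fun ht => ⟨logSub t, expSub_logSub ht⟩⟩

theorem injOn_expSub : InjOn expSub univ :=
  (Function.LeftInverse.injective logSub_expSub).injOn

theorem hasDerivAt_expSub (u : ℝ) : HasDerivAt expSub (-(2 * Real.pi * expSub u)) u :=
  ((hasDerivAt_id u).const_mul (2 * Real.pi)).neg.exp.congr_deriv (by simp [expSub]; ring)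

theorem abs_deriv_expSub (u : ℝ) : |-(2 * Real.pi * expSub u)| = 2 * Real.pi * expSub u := by
  have := expSub_pos u
  rw [abs_neg, abs_of_pos (by positivity)]

theorem lintegral_expSub (k : ℝ → ℝ≥0∞) :
    ∫⁻ t in Ioi 0, k t = ∫⁻ u, ENNReal.ofReal (2 * Real.pi * expSub u) * k (expSub u) := by
  rw [← expSub_image_univ, lintegral_image_eq_lintegral_abs_deriv_mul MeasurableSet.univ
    (fun u _ => (hasDerivAt_expSub u).hasDerivWithinAt) injOn_expSub]
  simp only [abs_deriv_expSub, Measure.restrict_univ]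

theorem integral_expSub {E : Type*} [NormedAddCommGroup E] [NormedSpace ℝ E] (k : ℝ → E) :
    ∫ t in Ioi 0, k t = ∫ u, (2 * Real.pi * expSub u) • k (expSub u) := by
  rw [← expSub_image_univ, integral_image_eq_integral_abs_deriv_smul MeasurableSet.univ
    (fun u _ => (hasDerivAt_expSub u).hasDerivWithinAt) injOn_expSub]
  simp only [abs_deriv_expSub, Measure.restrict_univ]

theorem integrableOn_expSub {E : Type*} [NormedAddCommGroup E] [NormedSpace ℝ E] (k : ℝ → E) :
    IntegrableOn k (Ioi 0) ↔ Integrable fun u => (2 * Real.pi * expSub u) • k (expSub u) := by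
  rw [← expSub_image_univ, integrableOn_image_iff_integrableOn_abs_deriv_smul MeasurableSet.univ
    (fun u _ => (hasDerivAt_expSub u).hasDerivWithinAt) injOn_expSub]
  simp only [abs_deriv_expSub, integrableOn_univ]

theorem quasiMeasurePreserving_expSub :
    Measure.QuasiMeasurePreserving expSub volume (volume.restrict (Ioi (0 : ℝ))) := by
  refine ⟨continuous_expSub.measurable, Measure.AbsolutelyContinuous.mk fun N hN h0 => ?_⟩
  rw [Measure.map_apply continuous_expSub.measurable hN]
  have hsub : expSub ⁻¹' N ⊆ logSub '' (N ∩ Ioi 0) := fun u hu =>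
    ⟨expSub u, ⟨hu, expSub_pos u⟩, logSub_expSub u⟩
  have hdiff : DifferentiableOn ℝ logSub (N ∩ Ioi 0) := fun t ht =>
    ((Real.differentiableAt_log (ne_of_gt ht.2)).neg.div_const _).differentiableWithinAt
  refine measure_mono_null hsub
    (addHaar_image_eq_zero_of_differentiableOn_of_addHaar_eq_zero _ hdiff ?_)
  rwa [← Measure.restrict_apply hN]

/-- The weighted substitution `f ↦ √(2π) e^{-πu} f(e^{-2πu})`. -/
def logPull (f : ℝ → ℂ) (u : ℝ) : ℂ := √(2 * Real.pi * expSub u) • f (expSub u)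

theorem lintegral_logPull (f : ℝ → ℂ) :
    ∫⁻ u, ‖logPull f u‖ₑ ^ 2 = ∫⁻ t in Ioi 0, ‖f t‖ₑ ^ 2 := by
  rw [lintegral_expSub]
  refine lintegral_congr fun u => ?_
  have := expSub_pos u
  rw [logPull, enorm_smul, mul_pow, Real.enorm_eq_ofReal (Real.sqrt_nonneg _),
    ← ENNReal.ofReal_pow (Real.sqrt_nonneg _), Real.sq_sqrt (by positivity)]

theorem eLpNorm_logPull (f : ℝ → ℂ) :
    eLpNorm (logPull f) 2 volume = eLpNorm f 2 (volume.restrict (Ioi 0)) := by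
  simp only [eLpNorm_two_eq_lintegral, lintegral_logPull]

theorem logPull_congr {f g : ℝ → ℂ} (h : f =ᵐ[volume.restrict (Ioi 0)] g) :
    logPull f =ᵐ[volume] logPull g := by
  filter_upwards [quasiMeasurePreserving_expSub.ae h] with u hu
  rw [logPull, logPull, hu]

theorem memLp_logPull {f : ℝ → ℂ} (hf : MemLp f 2 (volume.restrict (Ioi 0))) :
    MemLp (logPull f) 2 volume := by
  refine ⟨?_, (eLpNorm_logPull f).trans_lt hf.2⟩
  have hweight : Continuous fun u => √(2 * Real.pi * expSub u) := by fun_prop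
  exact hweight.aestronglyMeasurable.smul
    (hf.1.comp_quasiMeasurePreserving quasiMeasurePreserving_expSub)

/-- The isometry `L²(0, ∞) → L²(ℝ)` given by the weighted substitution. -/
def logIso : L2Inf →ₗᵢ[ℂ] Lp ℂ 2 (volume : Measure ℝ) where
  toFun f := (memLp_logPull (Lp.memLp f)).toLp _
  map_add' f g := by
    rw [← MemLp.toLp_add]
    refine MemLp.toLp_congr _ _ ((logPull_congr (Lp.coeFn_add f g)).trans ?_)
    exact Eventually.of_forall fun u => smul_add _ _ _
  map_smul' c f := by
    rw [RingHom.id_apply, ← MemLp.toLp_const_smul]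
    refine MemLp.toLp_congr _ _ ((logPull_congr (Lp.coeFn_smul c f)).trans ?_)
    exact Eventually.of_forall fun u => smul_comm _ c _
  norm_map' f := by
    simp only [LinearMap.coe_mk, AddHom.coe_mk]
    rw [Lp.norm_toLp, eLpNorm_logPull, Lp.norm_def]

theorem logIso_surjective : Function.Surjective logIso := by
  intro g
  let k : ℝ → ℂ := fun t => (√(2 * Real.pi * t))⁻¹ • g (logSub t)
  have hpull : logPull k = g := by
    funext u
    have := expSub_pos u
    rw [logPull, smul_inv_smul₀ (by positivity), logSub_expSub]
  have hk : MemLp k 2 (volume.restrict (Ioi 0)) := by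
    refine ⟨?_, by rw [← eLpNorm_logPull, hpull]; exact (Lp.memLp g).2⟩
    have hweight : Measurable fun t : ℝ => (√(2 * Real.pi * t))⁻¹ := by fun_prop
    exact hweight.aestronglyMeasurable.smul
      ((Lp.stronglyMeasurable g).comp_measurable measurable_logSub).aestronglyMeasurable
  refine ⟨hk.toLp k, Lp.ext ?_⟩
  refine (memLp_logPull (Lp.memLp _)).coeFn_toLp.trans ((logPull_congr hk.coeFn_toLp).trans ?_)
  rw [hpull]

theorem measurePreserving_toImag :
    MeasurePreserving (fun β : ℝ => (β : ℂ) * Complex.I) volume imagAxis :=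
  ⟨by fun_prop, rfl⟩

theorem measurableEmbedding_toImag : MeasurableEmbedding fun β : ℝ => (β : ℂ) * Complex.I :=
  (by fun_prop : Continuous fun β : ℝ => (β : ℂ) * Complex.I).measurableEmbedding
    fun β γ h => by simpa using congrArg Complex.im h

theorem ae_imagAxis_iff {p : ℂ → Prop} :
    (∀ᵐ s ∂imagAxis, p s) ↔ ∀ᵐ β : ℝ, p ((β : ℂ) * Complex.I) :=
  measurableEmbedding_toImag.ae_map_iff

theorem ae_re_eq_zero : ∀ᵐ s ∂imagAxis, s.re = 0 :=
  ae_imagAxis_iff.2 (Eventually.of_forall fun β => by simp)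

theorem integral_imagAxis {E : Type*} [NormedAddCommGroup E] [NormedSpace ℝ E] (f : ℂ → E) :
    ∫ s, f s ∂imagAxis = ∫ β : ℝ, f ((β : ℂ) * Complex.I) :=
  measurableEmbedding_toImag.integral_map f

/-- Restriction to the imaginary axis identifies `L²(iℝ)` with `L²(ℝ)`. -/
def imagIso : L2Imag ≃ₗᵢ[ℂ] Lp ℂ 2 (volume : Measure ℝ) :=
  LinearIsometryEquiv.ofSurjective (Lp.compMeasurePreservingₗᵢ ℂ _ measurePreserving_toImag) <| by
    intro g
    have hg : MemLp (fun s : ℂ => g s.im) 2 imagAxis := by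
      rw [imagAxis, measurableEmbedding_toImag.memLp_map_measure_iff]
      simpa [Function.comp_def] using Lp.memLp g
    refine ⟨hg.toLp _, Lp.ext ?_⟩
    refine (Lp.coeFn_compMeasurePreserving _ measurePreserving_toImag).trans ?_
    filter_upwards [ae_imagAxis_iff.1 hg.coeFn_toLp] with β hβ
    simp [hβ]

theorem imagIso_ae (g : L2Imag) : ∀ᵐ β : ℝ, imagIso g β = g ((β : ℂ) * Complex.I) :=
  Lp.coeFn_compMeasurePreserving g measurePreserving_toImag

/-- The modified Mellin transform as a unitary operator. -/
def mellinIso : L2Inf ≃ₗᵢ[ℂ] L2Imag :=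
  ((LinearIsometryEquiv.ofSurjective logIso logIso_surjective).trans
    (Lp.fourierTransformₗᵢ ℝ ℂ)).trans imagIso.symm

theorem mellinIso_ae_eq_fourier (f : L2Inf) :
    ∀ᵐ β : ℝ, mellinIso f ((β : ℂ) * Complex.I) =
      (𝓕 (logIso f) : Lp ℂ 2 (volume : Measure ℝ)) β := by
  have h : imagIso (mellinIso f) = 𝓕 (logIso f) := imagIso.apply_symm_apply _
  filter_upwards [imagIso_ae (mellinIso f)] with β hβ
  rw [← hβ, h]

/-- The modified Mellin transform `(2π)^{-1/2} ∫₀^∞ f(t) t^{s - 1/2} dt` of a function for which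
the integral converges absolutely. -/
def modMellin (f : ℝ → ℂ) (s : ℂ) : ℂ := ((√(2 * Real.pi) : ℝ) : ℂ)⁻¹ * mellin f (s + 1 / 2)

theorem ofReal_sqrt_two_pi_ne_zero : ((√(2 * Real.pi) : ℝ) : ℂ) ≠ 0 :=
  Complex.ofReal_ne_zero.2 (by positivity)

theorem smul_cpow_expSub (k : ℝ → ℂ) (u β : ℝ) :
    (2 * Real.pi * expSub u) •
        ((expSub u : ℂ) ^ ((β : ℂ) * Complex.I + 1 / 2 - 1) • k (expSub u)) =
      ((√(2 * Real.pi) : ℝ) : ℂ) *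
        (Complex.exp ((-2 * Real.pi * (β * u) : ℝ) * Complex.I) * logPull k u) := by
  have hpow : (expSub u : ℂ) ^ ((β : ℂ) * Complex.I + 1 / 2 - 1) =
      Complex.exp ((-2 * Real.pi * (β * u) : ℝ) * Complex.I) * ((√(expSub u))⁻¹ : ℝ) := by
    rw [Complex.cpow_def_of_ne_zero (by exact_mod_cast (expSub_pos u).ne'),
      ← Complex.ofReal_log (expSub_pos u).le, expSub, Real.log_exp, Real.sqrt_eq_rpow,
      ← Real.exp_mul, ← Real.exp_neg, Complex.ofReal_exp, ← Complex.exp_add]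
    congr 1
    push_cast
    ring
  have hweight : ((2 * Real.pi * expSub u : ℝ) : ℂ) * ((√(expSub u))⁻¹ : ℝ) =
      ((√(2 * Real.pi) : ℝ) : ℂ) * (√(2 * Real.pi * expSub u) : ℝ) := by
    rw [← Complex.ofReal_mul, ← Complex.ofReal_mul, Real.sqrt_mul (by positivity) (expSub u),
      ← mul_assoc √_, Real.mul_self_sqrt (by positivity), mul_assoc, ← div_eq_mul_inv,
      Real.div_sqrt]
  rw [hpow, logPull, smul_eq_mul, Complex.real_smul, Complex.real_smul]
  linear_combination
    Complex.exp ((-2 * Real.pi * (β * u) : ℝ) * Complex.I) * k (expSub u) * hweight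

theorem integrable_logPull {k : ℝ → ℂ} (hk : MellinConvergent k (1 / 2)) :
    Integrable (logPull k) := by
  refine (((integrableOn_expSub _).1 hk).const_mul ((√(2 * Real.pi) : ℝ) : ℂ)⁻¹).congr
    (Eventually.of_forall fun u => ?_)
  rw [inv_mul_eq_iff_eq_mul₀ ofReal_sqrt_two_pi_ne_zero]
  simpa using smul_cpow_expSub k u 0

theorem fourier_logPull (k : ℝ → ℂ) (β : ℝ) :
    𝓕 (logPull k) β = modMellin k ((β : ℂ) * Complex.I) := by
  simp_rw [modMellin, mellin, integral_expSub, smul_cpow_expSub, integral_const_mul,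
    inv_mul_cancel_left₀ ofReal_sqrt_two_pi_ne_zero, Real.fourier_eq', smul_eq_mul]
  simp

theorem mellinIso_ae_eq {f : L2Inf} {k : ℝ → ℂ} (hfk : f =ᵐ[volume.restrict (Ioi 0)] k)
    (hk : MellinConvergent k (1 / 2)) : mellinIso f =ᵐ[imagAxis] modMellin k := by
  have hpull : MemLp (logPull k) 2 volume := memLp_logPull ((memLp_congr_ae hfk).1 (Lp.memLp f))
  have hiso : logIso f = hpull.toLp _ :=
    MemLp.toLp_congr (memLp_logPull (Lp.memLp f)) _ (logPull_congr hfk)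
  refine ae_imagAxis_iff.2 ?_
  filter_upwards [mellinIso_ae_eq_fourier f,
    hiso ▸ fourier_toLp_ae_eq (integrable_logPull hk) hpull] with β hf hF
  rw [hf, hF, fourier_logPull]

theorem tendsto_eLpNorm_sub_indicator {α ι E : Type*} [MeasurableSpace α] [NormedAddCommGroup E]
    {μ : Measure α} {l : Filter ι} [l.IsCountablyGenerated] {S : ι → Set α} (hS : AECover μ l S)
    {f : α → E} (hf : MemLp f 2 μ) :
    Tendsto (fun i => eLpNorm (f - (S i).indicator f) 2 μ) l (𝓝 0) := by
  have hfin : ∫⁻ a, ‖f a‖ₑ ^ 2 ∂μ ≠ ∞ := by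
    have := hf.2
    rw [eLpNorm_two_eq_lintegral, ENNReal.rpow_lt_top_iff_of_pos one_half_pos] at this
    exact this.ne
  have hlim : Tendsto (fun i => ∫⁻ a, ‖(f - (S i).indicator f) a‖ₑ ^ 2 ∂μ) l (𝓝 0) := by
    rw [← lintegral_zero (μ := μ)]
    refine tendsto_lintegral_filter_of_dominated_convergence' (fun a => ‖f a‖ₑ ^ 2)
      (Eventually.of_forall fun i => ?_) (Eventually.of_forall fun i => ?_) hfin ?_
    · exact (hf.1.sub (hf.1.indicator (hS.measurableSet i))).enorm.pow_const 2
    · refine Eventually.of_forall fun a => ?_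
      by_cases h : a ∈ S i <;> simp [h]
    · filter_upwards [hS.ae_eventually_mem] with a ha
      refine tendsto_const_nhds.congr' ?_
      filter_upwards [ha] with i hi
      simp [hi]
  simpa [eLpNorm_two_eq_lintegral] using hlim.ennrpow_const (1 / 2 : ℝ)

theorem aecover_Ioc_inv : AECover (volume.restrict (Ioi 0)) atTop fun R : ℝ => Ioc R⁻¹ R := by
  have h := (aecover_Ioi_of_Ioi (μ := volume) (tendsto_inv_atTop_zero (𝕜 := ℝ))).inter
    (aecover_Iic (μ := volume.restrict (Ioi 0)) tendsto_id)
  simpa only [id, Ioi_inter_Iic] using h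

theorem mellinConvergent_indicator_Ioc {f : ℝ → ℂ} {a b : ℝ} (ha : 0 < a)
    (hf : IntegrableOn f (Icc a b)) (s : ℂ) : MellinConvergent ((Ioc a b).indicator f) s := by
  have hcpow : ContinuousOn (fun t : ℝ => (t : ℂ) ^ (s - 1)) (Icc a b) := fun t ht =>
    (Complex.continuousAt_ofReal_cpow_const t _
      (Or.inr (ha.trans_le ht.1).ne')).continuousWithinAt
  refine (((hf.continuousOn_mul hcpow isCompact_Icc).mono_set
    Ioc_subset_Icc_self).integrable_indicator measurableSet_Ioc).integrableOn.congr_fun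
    (fun t _ => ?_) measurableSet_Ioi
  by_cases h : t ∈ Ioc a b <;> simp [h]

theorem modMellin_indicator_Ioc (f : ℝ → ℂ) {a b : ℝ} (ha : 0 ≤ a) (hab : a ≤ b) (s : ℂ) :
    modMellin ((Ioc a b).indicator f) s =
      ((√(2 * Real.pi) : ℝ) : ℂ)⁻¹ * ∫ t in a..b, f t * (t : ℂ) ^ (s - 1 / 2) := by
  have hind (t : ℝ) : (t : ℂ) ^ (s + 1 / 2 - 1) • (Ioc a b).indicator f t =
      (Ioc a b).indicator (fun t : ℝ => f t * (t : ℂ) ^ (s - 1 / 2)) t := by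
    rw [show s + 1 / 2 - 1 = s - 1 / 2 by ring]
    by_cases h : t ∈ Ioc a b <;> simp [h, mul_comm]
  simp_rw [modMellin, mellin, hind]
  rw [setIntegral_indicator measurableSet_Ioc,
    inter_eq_right.2 (Ioc_subset_Ioi_self.trans (Ioi_subset_Ioi ha)),
    intervalIntegral.integral_of_le hab]

theorem isMellinTransform_mellinIso (f : L2Inf) : IsMellinTransform f (mellinIso f) := by
  refine (tendsto_eLpNorm_sub_indicator aecover_Ioc_inv (Lp.memLp f)).congr' ?_
  filter_upwards [eventually_ge_atTop (1 : ℝ)] with R hR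
  have hR0 : 0 < R⁻¹ := inv_pos.2 (one_pos.trans_le hR)
  have hmem : MemLp ((Ioc R⁻¹ R).indicator f) 2 (volume.restrict (Ioi 0)) :=
    (Lp.memLp f).indicator measurableSet_Ioc
  have hint : IntegrableOn f (Icc R⁻¹ R) :=
    ((Lp.memLp f).mono_measure (Measure.restrict_mono_set _
      fun t ht => hR0.trans_le ht.1)).integrable one_le_two
  have hisom : eLpNorm (⇑f - (Ioc R⁻¹ R).indicator f) 2 (volume.restrict (Ioi 0)) =
      ‖mellinIso f - mellinIso (hmem.toLp _)‖ₑ := by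
    rw [← map_sub, ← ofReal_norm, mellinIso.norm_map, ofReal_norm, Lp.enorm_def]
    refine eLpNorm_congr_ae ?_
    filter_upwards [hmem.coeFn_toLp, Lp.coeFn_sub f (hmem.toLp _)] with t ht hsub
    rw [hsub, Pi.sub_apply, Pi.sub_apply, ht]
  rw [hisom, Lp.enorm_def]
  refine eLpNorm_congr_ae ?_
  filter_upwards [Lp.coeFn_sub (mellinIso f) (mellinIso (hmem.toLp _)),
    mellinIso_ae_eq hmem.coeFn_toLp (mellinConvergent_indicator_Ioc hR0 hint _)] with s hsub hs
  rw [hsub, Pi.sub_apply, hs,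
    modMellin_indicator_Ioc _ hR0.le ((inv_le_one_of_one_le₀ hR).trans hR)]

/-! ### Truncated powers -/

theorem ae_eq_zero_of_setIntegral_Ioc_eq_zero {E : Type*} [NormedAddCommGroup E]
    [NormedSpace ℝ E] [CompleteSpace E] {g : ℝ → E} {b : ℝ}
    (hg : ∀ c, IntegrableOn g (Ioc b c)) (h : ∀ c, b < c → ∫ t in Ioc b c, g t = 0) :
    ∀ᵐ t, b < t → g t = 0 := by
  have hloc : LocallyIntegrable ((Ioi b).indicator g) := locallyIntegrable_iff.2 fun K hK => by
    obtain ⟨c, hc⟩ := hK.bddAbove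
    rw [IntegrableOn, integrable_indicator_iff measurableSet_Ioi, IntegrableOn,
      Measure.restrict_restrict measurableSet_Ioi]
    exact (hg c).mono_set fun t ht => ⟨ht.1, hc ht.2⟩
  filter_upwards [LocallyIntegrable.ae_hasDerivAt_integral hloc] with t ht hbt
  rw [← indicator_of_mem (show t ∈ Ioi b from hbt) g]
  refine (ht b).unique ((hasDerivAt_const t (0 : E)).congr_of_eventuallyEq ?_)
  filter_upwards [lt_mem_nhds hbt] with c hc
  rw [intervalIntegral.integral_of_le (le_of_lt hc), setIntegral_indicator measurableSet_Ioi,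
    inter_eq_left.2 Ioc_subset_Ioi_self, h c hc]

theorem inner_toLp_indicator {α : Type*} [MeasurableSpace α] {μ : Measure α} {S : Set α}
    (hS : MeasurableSet S) {k : α → ℂ} (hk : MemLp (S.indicator k) 2 μ) (f : Lp ℂ 2 μ) :
    inner ℂ (hk.toLp _) f = ∫ a in S, starRingEnd ℂ (k a) * f a ∂μ := by
  rw [L2.inner_def, ← integral_indicator hS]
  refine integral_congr_ae ?_
  filter_upwards [hk.coeFn_toLp] with a ha
  rw [ha]
  by_cases h : a ∈ S <;> simp [h, mul_comm]

theorem integrableOn_conj_mul {α : Type*} [MeasurableSpace α] {μ : Measure α} {S : Set α}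
    (hS : MeasurableSet S) {k : α → ℂ} (hk : MemLp (S.indicator k) 2 μ) (f : Lp ℂ 2 μ) :
    IntegrableOn (fun a => starRingEnd ℂ (k a) * f a) S μ :=
  ((memLp_indicator_iff_restrict hS).1 hk).star.integrable_mul
    ((Lp.memLp f).mono_measure Measure.restrict_le_self)

theorem conj_cpow_of_pos {t : ℝ} (ht : 0 < t) (a : ℂ) :
    starRingEnd ℂ ((t : ℂ) ^ a) = (t : ℂ) ^ starRingEnd ℂ a := by
  rw [Complex.cpow_conj _ _ (by simpa [Complex.arg_ofReal_of_nonneg ht.le] using Real.pi_pos.ne),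
    Complex.conj_ofReal]

theorem memLp_indicator_cpow {S : Set ℝ} (hS : MeasurableSet S) (hS0 : S ⊆ Ioi 0) {a : ℂ}
    (h : IntegrableOn (fun t : ℝ => t ^ (2 * a.re)) S) :
    MemLp (S.indicator fun t : ℝ => (t : ℂ) ^ a) 2 (volume.restrict (Ioi 0)) := by
  rw [memLp_indicator_iff_restrict hS, Measure.restrict_restrict hS, inter_eq_left.2 hS0,
    memLp_two_iff_integrable_sq_norm (Complex.measurable_ofReal.pow_const a).aestronglyMeasurable]
  refine h.congr_fun (fun t ht => ?_) hS
  rw [Complex.norm_cpow_eq_rpow_re_of_pos (hS0 ht), ← Real.rpow_mul_natCast (le_of_lt (hS0 ht))]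
  norm_num [mul_comm]

theorem memLp_lowPow {a : ℂ} (ha : -1 / 2 < a.re) (c : ℝ) :
    MemLp ((Ioc 0 c).indicator fun t : ℝ => (t : ℂ) ^ a) 2 (volume.restrict (Ioi 0)) :=
  memLp_indicator_cpow measurableSet_Ioc Ioc_subset_Ioi_self
    (intervalIntegral.intervalIntegrable_rpow' (by linarith)).1

theorem memLp_highPow {a : ℂ} (ha : a.re < -1 / 2) {c : ℝ} (hc : 0 < c) :
    MemLp ((Ioi c).indicator fun t : ℝ => (t : ℂ) ^ a) 2 (volume.restrict (Ioi 0)) :=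
  memLp_indicator_cpow measurableSet_Ioi (Ioi_subset_Ioi hc.le)
    (integrableOn_Ioi_rpow_of_lt (by linarith) hc)

/-- The power `t ^ a` truncated to `(0, c]`, as an element of `L²(0, ∞)`. -/
def lowPow (a : ℂ) (ha : -1 / 2 < a.re) (c : ℝ) : L2Inf := (memLp_lowPow ha c).toLp _

/-- The power `t ^ a` truncated to `(c, ∞)`, as an element of `L²(0, ∞)`. -/
def highPow (a : ℂ) (ha : a.re < -1 / 2) (c : ℝ) (hc : 0 < c) : L2Inf :=
  (memLp_highPow ha hc).toLp _

theorem lowPow_ae_eq {a : ℂ} (ha : -1 / 2 < a.re) (c : ℝ) :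
    lowPow a ha c =ᵐ[volume.restrict (Ioi 0)] (Ioc 0 c).indicator fun t : ℝ => (t : ℂ) ^ a :=
  (memLp_lowPow ha c).coeFn_toLp

theorem highPow_ae_eq {a : ℂ} (ha : a.re < -1 / 2) {c : ℝ} (hc : 0 < c) :
    highPow a ha c hc =ᵐ[volume.restrict (Ioi 0)] (Ioi c).indicator fun t : ℝ => (t : ℂ) ^ a :=
  (memLp_highPow ha hc).coeFn_toLp

theorem inner_lowPow {a : ℂ} (ha : -1 / 2 < a.re) (c : ℝ) (f : L2Inf) :
    inner ℂ (lowPow a ha c) f = ∫ t in Ioc 0 c, starRingEnd ℂ ((t : ℂ) ^ a) * f t := by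
  rw [lowPow, inner_toLp_indicator measurableSet_Ioc, Measure.restrict_restrict measurableSet_Ioc,
    inter_eq_left.2 Ioc_subset_Ioi_self]

theorem inner_highPow {a : ℂ} (ha : a.re < -1 / 2) {c : ℝ} (hc : 0 < c) (f : L2Inf) :
    inner ℂ (highPow a ha c hc) f = ∫ t in Ioi c, starRingEnd ℂ ((t : ℂ) ^ a) * f t := by
  rw [highPow, inner_toLp_indicator measurableSet_Ioi,
    Measure.restrict_restrict measurableSet_Ioi, inter_eq_left.2 (Ioi_subset_Ioi hc.le)]

theorem dense_span_lowPow_zero :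
    Dense (Submodule.span ℂ {f : L2Inf | ∃ c, 0 < c ∧ f = lowPow 0 (by norm_num) c} :
      Set L2Inf) := by
  rw [Submodule.dense_iff_topologicalClosure_eq_top, Submodule.topologicalClosure_eq_top_iff,
    Submodule.eq_bot_iff]
  intro f hf
  have hzero : ∀ᵐ t : ℝ, 0 < t → f t = 0 := by
    refine ae_eq_zero_of_setIntegral_Ioc_eq_zero (fun c => ?_) fun c hc => ?_
    · exact ((Lp.memLp f).mono_measure
        (Measure.restrict_mono_set _ Ioc_subset_Ioi_self)).integrable one_le_two
    · simpa [inner_lowPow] using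
        (Submodule.mem_orthogonal _ _).1 hf _ (Submodule.subset_span ⟨c, hc, rfl⟩)
  exact (Lp.eq_zero_iff_ae_eq_zero).2 ((ae_restrict_iff' measurableSet_Ioi).2 hzero)

theorem ae_eq_zero_of_inner_highPow {a : ℂ} (ha : a.re < -1 / 2) {b : ℝ} (hb : 0 < b) {f : L2Inf}
    (h : ∀ c (hc : b ≤ c), inner ℂ (highPow a ha c (hb.trans_le hc)) f = 0) :
    ∀ᵐ t : ℝ, b < t → f t = 0 := by
  have hint : IntegrableOn (fun t : ℝ => starRingEnd ℂ ((t : ℂ) ^ a) * f t) (Ioi b) := by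
    simpa only [IntegrableOn, Measure.restrict_restrict measurableSet_Ioi,
      inter_eq_left.2 (Ioi_subset_Ioi hb.le)] using
      integrableOn_conj_mul measurableSet_Ioi (memLp_highPow ha hb) f
  have hzero : ∀ᵐ t : ℝ, b < t → starRingEnd ℂ ((t : ℂ) ^ a) * f t = 0 := by
    refine ae_eq_zero_of_setIntegral_Ioc_eq_zero
      (fun c => hint.mono_set Ioc_subset_Ioi_self) fun c hc => ?_
    rw [← intervalIntegral.integral_of_le hc.le,
      ← intervalIntegral.integral_Ioi_sub_Ioi hint hc.le, ← inner_highPow ha hb,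
      ← inner_highPow ha (hb.trans hc), h b le_rfl, h c hc.le, sub_zero]
  filter_upwards [hzero] with t ht hbt
  have : (t : ℂ) ≠ 0 := by exact_mod_cast (hb.trans hbt).ne'
  simpa [this] using ht hbt

theorem lowPow_sub_hardyInf {c : ℝ} (hc : 0 < c) :
    lowPow 0 (by norm_num) c - hardyInf (lowPow 0 (by norm_num) c) =
      (-c : ℂ) • highPow (-1) (by norm_num) c hc := by
  have h0 : -1 / 2 < (0 : ℂ).re := by norm_num
  have h1 : (-1 : ℂ).re < -1 / 2 := by norm_num
  have hhardy : hardyInf (lowPow 0 h0 c) =ᵐ[volume.restrict (Ioi 0)] average (lowPow 0 h0 c) :=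
    (memLp_average isInitial_Ioi _).coeFn_toLp
  refine Lp.ext ?_
  filter_upwards [Lp.coeFn_sub (lowPow 0 h0 c) (hardyInf (lowPow 0 h0 c)),
    lowPow_ae_eq h0 c, hhardy, Lp.coeFn_smul (-c : ℂ) (highPow (-1) h1 c hc),
    highPow_ae_eq h1 hc, ae_restrict_mem measurableSet_Ioi] with x hsub hlow havg hsmul hhigh hx
  have hx : 0 < x := hx
  have hx' : (x : ℂ) ≠ 0 := by exact_mod_cast hx.ne'
  rw [hsub, hsmul, Pi.sub_apply, Pi.smul_apply, havg,
    average_congr isInitial_Ioi (lowPow_ae_eq h0 c) hx, hhigh, hlow, average,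
    intervalIntegral.integral_of_le hx.le, setIntegral_indicator measurableSet_Ioc, Ioc_inter_Ioc]
  rcases le_or_gt x c with h | h
  · simp [hx, h, hx.le, hx']
  · simp [h, hc.le, h.le, mul_comm, Complex.cpow_neg_one]

theorem ofReal_cpow_smul_indicator_cpow {S : Set ℝ} (s a : ℂ) {t : ℝ} (ht : t ∈ Ioi 0) :
    (t : ℂ) ^ (s - 1) • S.indicator (fun t : ℝ => (t : ℂ) ^ a) t =
      S.indicator (fun t : ℝ => (t : ℂ) ^ (s + a - 1)) t := by
  have ht0 : (t : ℂ) ≠ 0 := by exact_mod_cast (ne_of_gt ht : t ≠ 0)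
  by_cases h : t ∈ S
  · rw [indicator_of_mem h, indicator_of_mem h, smul_eq_mul, ← Complex.cpow_add _ _ ht0]
    ring_nf
  · simp [h]

theorem hasMellin_indicator_cpow {S : Set ℝ} (hS : MeasurableSet S) (hS0 : S ⊆ Ioi 0) {a s : ℂ}
    (h : IntegrableOn (fun t : ℝ => (t : ℂ) ^ (s + a - 1)) S) :
    HasMellin (S.indicator fun t : ℝ => (t : ℂ) ^ a) s
      (∫ t : ℝ in S, (t : ℂ) ^ (s + a - 1)) := by
  refine ⟨?_, ?_⟩
  · exact (h.integrable_indicator hS).integrableOn.congr_fun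
      (fun t ht => (ofReal_cpow_smul_indicator_cpow s a ht).symm) measurableSet_Ioi
  · rw [mellin, setIntegral_congr_fun measurableSet_Ioi
      fun t ht => ofReal_cpow_smul_indicator_cpow s a ht, setIntegral_indicator hS,
      inter_eq_right.2 hS0]

theorem hasMellin_indicator_Ioc_cpow {a s : ℂ} (h : 0 < (s + a).re) {c : ℝ} (hc : 0 < c) :
    HasMellin ((Ioc 0 c).indicator fun t : ℝ => (t : ℂ) ^ a) s ((c : ℂ) ^ (s + a) / (s + a)) := by
  have hre : -1 < (s + a - 1).re := by simpa using h
  have hne : s + a ≠ 0 := fun h0 => by simp [h0] at h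
  convert hasMellin_indicator_cpow measurableSet_Ioc Ioc_subset_Ioi_self
    (intervalIntegral.intervalIntegrable_cpow' hre).1 using 1
  rw [← intervalIntegral.integral_of_le hc.le, integral_cpow (Or.inl hre), sub_add_cancel,
    Complex.ofReal_zero, Complex.zero_cpow hne, sub_zero]

theorem hasMellin_indicator_Ioi_cpow {a s : ℂ} (h : (s + a).re < 0) {c : ℝ} (hc : 0 < c) :
    HasMellin ((Ioi c).indicator fun t : ℝ => (t : ℂ) ^ a) s
      (-((c : ℂ) ^ (s + a) / (s + a))) := by
  have hre : (s + a - 1).re < -1 := by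
    rw [Complex.sub_re, Complex.one_re]
    linarith
  convert hasMellin_indicator_cpow measurableSet_Ioi (Ioi_subset_Ioi hc.le)
    (integrableOn_Ioi_cpow_of_lt hre hc) using 1
  rw [integral_Ioi_cpow_of_lt hre hc, sub_add_cancel, neg_div]

theorem mellinIso_lowPow {a : ℂ} (ha : -1 / 2 < a.re) {c : ℝ} (hc : 0 < c) :
    ∀ᵐ s ∂imagAxis, mellinIso (lowPow a ha c) s =
      ((√(2 * Real.pi) : ℝ) : ℂ)⁻¹ * ((c : ℂ) ^ (s + 1 / 2 + a) / (s + 1 / 2 + a)) := by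
  have hre {s : ℂ} (hs : s.re = 0) : 0 < (s + 1 / 2 + a).re := by
    norm_num [hs]
    linarith
  filter_upwards [mellinIso_ae_eq (lowPow_ae_eq ha c) (by
    simpa using (hasMellin_indicator_Ioc_cpow (hre Complex.zero_re) hc).1), ae_re_eq_zero]
    with s hs hs0
  rw [hs, modMellin, (hasMellin_indicator_Ioc_cpow (hre hs0) hc).2]

theorem mellinIso_highPow {a : ℂ} (ha : a.re < -1 / 2) {c : ℝ} (hc : 0 < c) :
    ∀ᵐ s ∂imagAxis, mellinIso (highPow a ha c hc) s =
      ((√(2 * Real.pi) : ℝ) : ℂ)⁻¹ * -((c : ℂ) ^ (s + 1 / 2 + a) / (s + 1 / 2 + a)) := by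
  have hre {s : ℂ} (hs : s.re = 0) : (s + 1 / 2 + a).re < 0 := by
    norm_num [hs]
    linarith
  filter_upwards [mellinIso_ae_eq (highPow_ae_eq ha hc) (by
    simpa using (hasMellin_indicator_Ioi_cpow (hre Complex.zero_re) hc).1), ae_re_eq_zero]
    with s hs hs0
  rw [hs, modMellin, (hasMellin_indicator_Ioi_cpow (hre hs0) hc).2]

/-! ### The intertwining relations -/

theorem mulPhi_ae (g : L2Imag) : ∀ᵐ s ∂imagAxis, mulPhi g s = phi s * g s := by
  filter_upwards [(ContinuousLinearMap.mul ℂ ℂ).coeFn_holder (r := 2) (memLp_phi.toLp phi) g,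
    memLp_phi.coeFn_toLp] with s hmul hphi
  rw [← hphi]
  exact hmul

theorem add_half_ne_zero {z : ℂ} (hz : 0 ≤ z.re) : z + 1 / 2 ≠ 0 := fun h => by
  have := congrArg Complex.re h
  norm_num at this
  linarith

theorem measurePreserving_neg_imagAxis :
    MeasurePreserving (fun s : ℂ => -s) imagAxis imagAxis := by
  refine ⟨measurable_neg, ?_⟩
  have hcomm : (fun s : ℂ => -s) ∘ (fun β : ℝ => (β : ℂ) * Complex.I) =
      (fun β : ℝ => (β : ℂ) * Complex.I) ∘ fun β : ℝ => -β := by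
    funext β
    simp
  rw [imagAxis, Measure.map_map measurable_neg measurePreserving_toImag.measurable, hcomm,
    ← Measure.map_map measurePreserving_toImag.measurable measurable_neg, Measure.map_neg_eq_self]

theorem ae_neg_imagAxis {p : ℂ → Prop} (h : ∀ᵐ s ∂imagAxis, p s) : ∀ᵐ s ∂imagAxis, p (-s) :=
  measurePreserving_neg_imagAxis.quasiMeasurePreserving.ae h

/-- The reflection `g(s) ↦ g(-s)` on `L²(iℝ)`. -/
def reflection : L2Imag ≃ₗᵢ[ℂ] L2Imag :=
  LinearIsometryEquiv.ofSurjective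
    (Lp.compMeasurePreservingₗᵢ ℂ _ measurePreserving_neg_imagAxis) fun g => by
      have hcoe (g : L2Imag) := Lp.coeFn_compMeasurePreserving g measurePreserving_neg_imagAxis
      refine ⟨Lp.compMeasurePreservingₗᵢ ℂ _ measurePreserving_neg_imagAxis g, Lp.ext ?_⟩
      refine (hcoe _).trans ?_
      filter_upwards [ae_neg_imagAxis (hcoe g)] with s hs
      simpa using hs

/-- The reflected Mellin transform `f ↦ (s ↦ (Q f)(-s))`. -/
def mellinReflIso : L2Inf ≃ₗᵢ[ℂ] L2Imag := mellinIso.trans reflection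

theorem mellinReflIso_ae (f : L2Inf) : ∀ᵐ s ∂imagAxis, mellinReflIso f s = mellinIso f (-s) :=
  Lp.coeFn_compMeasurePreserving (mellinIso f) measurePreserving_neg_imagAxis

theorem mellinReflIso_lowPow_sub_hardyInf {c : ℝ} (hc : 0 < c) :
    mellinReflIso (lowPow 0 (by norm_num) c - hardyInf (lowPow 0 (by norm_num) c)) =
      mulPhi (mellinReflIso (lowPow 0 (by norm_num) c)) := by
  have h0 : -1 / 2 < (0 : ℂ).re := by norm_num
  have h1 : (-1 : ℂ).re < -1 / 2 := by norm_num
  have hc0 : (c : ℂ) ≠ 0 := by exact_mod_cast hc.ne'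
  rw [lowPow_sub_hardyInf hc, map_smul]
  refine Lp.ext ?_
  filter_upwards [Lp.coeFn_smul (-c : ℂ) (mellinReflIso (highPow (-1) h1 c hc)),
    mellinReflIso_ae (highPow (-1) h1 c hc), ae_neg_imagAxis (mellinIso_highPow h1 hc),
    mulPhi_ae (mellinReflIso (lowPow 0 h0 c)), mellinReflIso_ae (lowPow 0 h0 c),
    ae_neg_imagAxis (mellinIso_lowPow h0 hc), ae_re_eq_zero]
    with s hsmul hrefl_high hhigh hmul hrefl_low hlow hs
  have hpos : s + 1 / 2 ≠ 0 := add_half_ne_zero hs.ge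
  have hneg : -s + 1 / 2 ≠ 0 := add_half_ne_zero (by simp [hs])
  have hpow : (c : ℂ) ^ (-s + 1 / 2 + 0) = (c : ℂ) ^ (-s + 1 / 2 + -1) * c := by
    rw [add_zero, ← sub_eq_add_neg _ (1 : ℂ), Complex.cpow_sub _ _ hc0, Complex.cpow_one,
      div_mul_cancel₀ _ hc0]
  rw [hsmul, Pi.smul_apply, hrefl_high, hhigh, hmul, hrefl_low, hlow, hpow, smul_eq_mul, phi,
    show -s + 1 / 2 + -1 = -(s + 1 / 2) by ring, show s - 1 / 2 = -(-s + 1 / 2) by ring, add_zero]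
  generalize s + 1 / 2 = p at hpos
  generalize -s + 1 / 2 = q at hneg
  field_simp

theorem mellinReflIso_sub_hardyInf (f : L2Inf) :
    mellinReflIso (f - hardyInf f) = mulPhi (mellinReflIso f) := by
  let V : L2Inf →L[ℂ] L2Imag := mellinReflIso
  have hV : V ∘L (ContinuousLinearMap.id ℂ L2Inf - hardyInf) = mulPhi ∘L V := by
    refine ContinuousLinearMap.ext_on dense_span_lowPow_zero ?_
    rintro _ ⟨c, hc, rfl⟩
    exact mellinReflIso_lowPow_sub_hardyInf hc
  exact DFunLike.congr_fun hV f

theorem mellinIso_sub_hardyInf (f : L2Inf) :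
    ∀ᵐ s ∂imagAxis, mellinIso (f - hardyInf f) s = phi (-s) * mellinIso f s := by
  have hrefl := mellinReflIso_ae (f - hardyInf f)
  rw [mellinReflIso_sub_hardyInf] at hrefl
  filter_upwards [ae_neg_imagAxis hrefl, ae_neg_imagAxis (mulPhi_ae (mellinReflIso f)),
    ae_neg_imagAxis (mellinReflIso_ae f)] with s hsub hmul hf
  rw [neg_neg] at hsub hf
  rw [← hsub, hmul, hf]

theorem conj_phi {s : ℂ} (hs : s.re = 0) : starRingEnd ℂ (phi s) = phi (-s) := by
  have hconj : starRingEnd ℂ s = -s := by apply Complex.ext <;> simp [hs]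
  simp only [phi, map_div₀, map_sub, map_add, map_one, map_ofNat, hconj]

theorem mellinIso_sub_adjoint_hardyInf (f : L2Inf) :
    mellinIso (f - ContinuousLinearMap.adjoint hardyInf f) = mulPhi (mellinIso f) := by
  refine ext_inner_right ℂ fun g => ?_
  obtain ⟨k, rfl⟩ := mellinIso.surjective g
  calc inner ℂ (mellinIso (f - ContinuousLinearMap.adjoint hardyInf f)) (mellinIso k)
      = inner ℂ (mellinIso f) (mellinIso (k - hardyInf k)) := by
        rw [mellinIso.inner_map_map, inner_sub_left, ContinuousLinearMap.adjoint_inner_left,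
          ← inner_sub_right, mellinIso.inner_map_map]
    _ = inner ℂ (mulPhi (mellinIso f)) (mellinIso k) := by
        rw [L2.inner_def, L2.inner_def]
        refine integral_congr_ae ?_
        filter_upwards [mellinIso_sub_hardyInf k, mulPhi_ae (mellinIso f), ae_re_eq_zero]
          with s hk hf hs
        rw [hk, hf, RCLike.inner_apply, RCLike.inner_apply, map_mul, conj_phi hs]
        ring

/-! ### The finite Hardy operator -/

theorem restrict_Ioo_le_restrict_Ioi :
    (volume : Measure ℝ).restrict (Ioo 0 1) ≤ volume.restrict (Ioi 0) :=
  Measure.restrict_mono_set _ Ioo_subset_Ioi_self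

theorem memLp_restrict_Ioo (k : L2Inf) : MemLp k 2 (volume.restrict (Ioo 0 1)) :=
  (Lp.memLp k).mono_measure restrict_Ioo_le_restrict_Ioi

theorem extendZero_ae_eq (f : L2One) :
    extendZero f =ᵐ[volume.restrict (Ioi 0)] (Ioo 0 1).indicator f :=
  (memLp_extend f).coeFn_toLp

theorem inner_extendZero (f : L2One) (k : L2Inf) :
    inner ℂ (extendZero f) k = inner ℂ f ((memLp_restrict_Ioo k).toLp k) := by
  have h := inner_toLp_indicator measurableSet_Ioo (memLp_extend f) k
  rw [Measure.restrict_restrict measurableSet_Ioo, inter_eq_left.2 Ioo_subset_Ioi_self] at h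
  refine h.trans ?_
  rw [L2.inner_def]
  refine integral_congr_ae ?_
  filter_upwards [(memLp_restrict_Ioo k).coeFn_toLp] with t ht
  rw [ht, RCLike.inner_apply, mul_comm]

theorem hardyOne_toLp (k : L2Inf) :
    hardyOne ((memLp_restrict_Ioo k).toLp k) =
      (memLp_restrict_Ioo (hardyInf k)).toLp (hardyInf k) := by
  have hInf : hardyInf k =ᵐ[volume.restrict (Ioi 0)] average k :=
    (memLp_average isInitial_Ioi k).coeFn_toLp
  refine MemLp.toLp_congr (memLp_average isInitial_Ioo _) _ ?_
  filter_upwards [ae_mono restrict_Ioo_le_restrict_Ioi hInf, ae_restrict_mem measurableSet_Ioo]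
    with x hx hx01
  rw [hx]
  exact average_congr isInitial_Ioo (memLp_restrict_Ioo k).coeFn_toLp hx01

theorem adjoint_hardyInf_extendZero (f : L2One) :
    ContinuousLinearMap.adjoint hardyInf (extendZero f) =
      extendZero (ContinuousLinearMap.adjoint hardyOne f) := by
  refine ext_inner_right ℂ fun k => ?_
  rw [ContinuousLinearMap.adjoint_inner_left, inner_extendZero, inner_extendZero,
    ContinuousLinearMap.adjoint_inner_left, hardyOne_toLp]

theorem extendZero_sub_adjoint_hardyInf (f : L2One) :
    extendZero f - ContinuousLinearMap.adjoint hardyInf (extendZero f) =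
      extendZero (f - ContinuousLinearMap.adjoint hardyOne f) := by
  rw [adjoint_hardyInf_extendZero, map_sub]

/-! ### Invariance of the Hardy space -/

theorem differentiableAt_phi {z : ℂ} (hz : 0 ≤ z.re) : DifferentiableAt ℂ phi z := by
  unfold phi
  exact DifferentiableAt.div (by fun_prop) (by fun_prop) (add_half_ne_zero hz)

theorem norm_phi_le_one {z : ℂ} (hz : 0 < z.re) : ‖phi z‖ ≤ 1 := by
  rw [phi, norm_div]
  refine div_le_one_of_le₀ ?_ (norm_nonneg _)
  rw [← sq_le_sq₀ (norm_nonneg _) (norm_nonneg _), ← Complex.normSq_eq_norm_sq,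
    ← Complex.normSq_eq_norm_sq, Complex.normSq_apply, Complex.normSq_apply]
  norm_num
  nlinarith

theorem tendsto_ofReal_add_nhdsGT (s : ℂ) :
    Tendsto (fun x : ℝ => (x : ℂ) + s) (𝓝[>] 0) (𝓝 s) := by
  have h : Continuous fun x : ℝ => (x : ℂ) + s := by fun_prop
  simpa using (h.tendsto 0).mono_left nhdsWithin_le_nhds

theorem mulPhi_mem_hardyPlus {g : L2Imag} (hg : g ∈ hardyPlus) : mulPhi g ∈ hardyPlus := by
  obtain ⟨F, ⟨hdiff, hbound⟩, hlim⟩ := hg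
  refine ⟨fun z => phi z * F z, ⟨?_, ?_⟩, ?_⟩
  · exact DifferentiableOn.mul
      (fun z hz => (differentiableAt_phi (le_of_lt hz)).differentiableWithinAt) hdiff
  · refine lt_of_le_of_lt (iSup₂_mono fun x hx => lintegral_mono fun y => ?_) hbound
    gcongr ?_ ^ 2
    rw [enorm_mul]
    refine mul_le_of_le_one_left' ?_
    rw [← ofReal_norm]
    exact ENNReal.ofReal_le_one.2 (norm_phi_le_one (by simpa using hx))
  · filter_upwards [hlim, mulPhi_ae g, ae_re_eq_zero] with s hF hmul hs
    rw [hmul]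
    exact ((differentiableAt_phi hs.ge).continuousAt.tendsto.comp
      (tendsto_ofReal_add_nhdsGT s)).mul hF

/-! ### Weak convergence of bounded, almost everywhere convergent sequences -/

section WeakConvergence

variable {α : Type*} [MeasurableSpace α] {μ : Measure α}

theorem eLpNorm_indicator_mul_le {f k : α → ℂ} (hf : AEStronglyMeasurable f μ)
    (hk : AEStronglyMeasurable k μ) {S : Set α} (hS : MeasurableSet S) :
    eLpNorm (S.indicator fun a => f a * k a) 1 μ ≤
      eLpNorm f 2 μ * eLpNorm (S.indicator k) 2 μ := by
  have h : (S.indicator fun a => f a * k a) = f • S.indicator k := by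
    funext a
    by_cases ha : a ∈ S <;> simp [ha]
  rw [h]
  exact eLpNorm_smul_le_mul_eLpNorm (hk.indicator hS) hf

variable {ι : Type*} {f : ι → α → ℂ} {k : α → ℂ} {C : NNReal}

theorem unifIntegrable_mul (hf : ∀ n, AEStronglyMeasurable (f n) μ)
    (hfC : ∀ n, eLpNorm (f n) 2 μ ≤ C) (hk : MemLp k 2 μ) :
    UnifIntegrable (fun n a => f n a * k a) 1 μ := by
  intro ε hε
  obtain ⟨δ, hδ, h⟩ := hk.eLpNorm_indicator_le one_le_two ENNReal.ofNat_ne_top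
    (show 0 < ε / (C + 1) by positivity)
  refine ⟨δ, hδ, fun n S hS hμ => (eLpNorm_indicator_mul_le (hf n) hk.1 hS).trans ?_⟩
  refine (mul_le_mul' (hfC n) (h S hS hμ)).trans ?_
  rw [← ENNReal.ofReal_coe_nnreal, ← ENNReal.ofReal_mul C.coe_nonneg]
  refine ENNReal.ofReal_le_ofReal ?_
  rw [mul_div_assoc', div_le_iff₀ (by positivity)]
  nlinarith [C.coe_nonneg]

theorem unifTight_mul (hf : ∀ n, AEStronglyMeasurable (f n) μ)
    (hfC : ∀ n, eLpNorm (f n) 2 μ ≤ C) (hk : MemLp k 2 μ) :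
    UnifTight (fun n a => f n a * k a) 1 μ := by
  intro ε hε
  have hε' : (ε / (C + 1) : NNReal) ≠ 0 := by positivity
  obtain ⟨S, hS, hμ, h⟩ := hk.exists_eLpNorm_indicator_compl_lt ENNReal.ofNat_ne_top
    (ENNReal.coe_ne_zero.2 hε')
  refine ⟨S, hμ.ne, fun n => (eLpNorm_indicator_mul_le (hf n) hk.1 hS.compl).trans ?_⟩
  refine (mul_le_mul' (hfC n) h.le).trans ?_
  rw [← ENNReal.coe_mul, ENNReal.coe_le_coe, mul_div_assoc', div_le_iff₀ (by positivity),
    mul_comm ε]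
  gcongr
  simp

theorem tendsto_integral_mul_of_ae_tendsto {f : ℕ → α → ℂ} {g : α → ℂ}
    (hf : ∀ n, AEStronglyMeasurable (f n) μ) (hfC : ∀ n, eLpNorm (f n) 2 μ ≤ C)
    (hg : MemLp g 2 μ) (hk : MemLp k 2 μ)
    (hlim : ∀ᵐ a ∂μ, Tendsto (fun n => f n a) atTop (𝓝 (g a))) :
    Tendsto (fun n => ∫ a, f n a * k a ∂μ) atTop (𝓝 (∫ a, g a * k a ∂μ)) := by
  have hfk (n : ℕ) : Integrable (fun a => f n a * k a) μ :=
    MemLp.integrable_mul ⟨hf n, (hfC n).trans_lt ENNReal.coe_lt_top⟩ hk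
  have hgk : Integrable (fun a => g a * k a) μ := hg.integrable_mul hk
  exact tendsto_integral_of_L1' _ hgk.1 (Eventually.of_forall hfk) <|
    tendsto_Lp_of_tendsto_ae le_rfl ENNReal.one_ne_top (fun n => (hfk n).1)
      (memLp_one_iff_integrable.2 hgk) (unifIntegrable_mul hf hfC hk) (unifTight_mul hf hfC hk)
      (hlim.mono fun a ha => ha.mul_const _)

end WeakConvergence

/-! ### Shifting vertical lines of integration -/

section VerticalShift

variable {E : Type*} [NormedAddCommGroup E] {G : ℂ → E} {a b : ℝ} {B : ℝ≥0∞}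

theorem integrable_vertical {x : ℝ} (hG : ContinuousOn G {z | z.re = x})
    (hGx : ∫⁻ y : ℝ, ‖G ((x : ℂ) + (y : ℂ) * Complex.I)‖ₑ ≠ ∞) :
    Integrable fun y : ℝ => G ((x : ℂ) + (y : ℂ) * Complex.I) :=
  ⟨(hG.comp_continuous (by fun_prop) fun y => by simp).aestronglyMeasurable, hGx.lt_top⟩

theorem integrable_strip (hG : ContinuousOn G {z | z.re ∈ Icc a b}) (hB : B ≠ ∞)
    (hGB : ∀ x ∈ Icc a b, ∫⁻ y : ℝ, ‖G ((x : ℂ) + (y : ℂ) * Complex.I)‖ₑ ≤ B) :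
    Integrable (fun p : ℝ × ℝ => G ((p.2 : ℂ) + (p.1 : ℂ) * Complex.I))
      (volume.prod (volume.restrict (Ioc a b))) := by
  have hmeas : AEStronglyMeasurable (fun p : ℝ × ℝ => G ((p.2 : ℂ) + (p.1 : ℂ) * Complex.I))
      (volume.prod (volume.restrict (Ioc a b))) := by
    rw [← Measure.restrict_univ (μ := (volume : Measure ℝ)), Measure.prod_restrict,
      Measure.restrict_univ]
    refine ContinuousOn.aestronglyMeasurable ?_ (MeasurableSet.univ.prod measurableSet_Ioc)
    exact hG.comp (by fun_prop) fun p hp => by simpa using Ioc_subset_Icc_self hp.2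
  refine ⟨hmeas, ?_⟩
  rw [HasFiniteIntegral, lintegral_prod_symm _ hmeas.enorm]
  calc _ ≤ ∫⁻ _ in Ioc a b, B :=
        setLIntegral_mono' measurableSet_Ioc fun x hx => hGB x (Ioc_subset_Icc_self hx)
    _ < ∞ := by
        rw [setLIntegral_const]
        exact ENNReal.mul_lt_top hB.lt_top measure_Ioc_lt_top

variable [NormedSpace ℂ E]

theorem boundary_strip_eq (hab : a ≤ b) (hG : DifferentiableOn ℂ G {z | z.re ∈ Icc a b})
    (T : ℝ) :
    (∫ x in a..b, G ((x : ℂ) + (T : ℂ) * Complex.I)) -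
        ∫ x in a..b, G ((x : ℂ) + ((-T : ℝ) : ℂ) * Complex.I) =
      Complex.I • ((∫ y in (-T)..T, G ((b : ℂ) + (y : ℂ) * Complex.I)) -
        ∫ y in (-T)..T, G ((a : ℂ) + (y : ℂ) * Complex.I)) := by
  have h := Complex.integral_boundary_rect_eq_zero_of_differentiableOn G ⟨a, -T⟩ ⟨b, T⟩
    (hG.mono fun z hz => uIcc_of_le hab ▸ hz.1)
  rw [smul_sub, ← sub_eq_zero, ← neg_eq_zero, ← h]
  abel

theorem integral_vertical_eq (hab : a ≤ b) (hG : DifferentiableOn ℂ G {z | z.re ∈ Icc a b})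
    (hB : B ≠ ∞) (hGB : ∀ x ∈ Icc a b, ∫⁻ y : ℝ, ‖G ((x : ℂ) + (y : ℂ) * Complex.I)‖ₑ ≤ B) :
    ∫ y : ℝ, G ((a : ℂ) + (y : ℂ) * Complex.I) = ∫ y : ℝ, G ((b : ℂ) + (y : ℂ) * Complex.I) := by
  let h : ℝ → E := fun y => ∫ x in a..b, G ((x : ℂ) + (y : ℂ) * Complex.I)
  have hint : Integrable h := by
    simpa only [h, intervalIntegral.integral_of_le hab] using
      (integrable_strip hG.continuousOn hB hGB).integral_prod_left
  have hvert {x : ℝ} (hx : x ∈ Icc a b) :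
      Tendsto (fun T : ℝ => ∫ y in (-T)..T, G ((x : ℂ) + (y : ℂ) * Complex.I)) atTop
        (𝓝 (∫ y : ℝ, G ((x : ℂ) + (y : ℂ) * Complex.I))) :=
    intervalIntegral_tendsto_integral (integrable_vertical
      (hG.continuousOn.mono fun z hz => by rwa [mem_ofPred_eq, show z.re = x from hz])
      (ne_top_of_le_ne_top hB (hGB x hx))) tendsto_neg_atTop_atBot tendsto_id
  have hlim : Tendsto (fun T => h T - h (-T)) atTop
      (𝓝 (Complex.I • ((∫ y : ℝ, G ((b : ℂ) + (y : ℂ) * Complex.I)) -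
        ∫ y : ℝ, G ((a : ℂ) + (y : ℂ) * Complex.I)))) := by
    simp_rw [h, boundary_strip_eq hab hG]
    exact ((hvert (right_mem_Icc.2 hab)).sub (hvert (left_mem_Icc.2 hab))).const_smul _
  -- An integrable function of the height `T` can only tend to zero.
  have hzero := IntegrableAtFilter.eq_zero_of_tendsto
    ((hint.sub hint.comp_neg).integrableAtFilter atTop)
    (fun S hS => top_le_iff.1 ?_) hlim
  · exact (sub_eq_zero.1 ((smul_eq_zero.1 hzero).resolve_left Complex.I_ne_zero)).symm
  · obtain ⟨T, hT⟩ := mem_atTop_sets.1 hS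
    rw [← Real.volume_Ici (a := T)]
    exact measure_mono hT

end VerticalShift

/-! ### Boundary functions come from `L²(0, 1)` -/

theorem integrable_inv_sq_add_sq {r : ℝ} (hr : 0 < r) :
    Integrable fun y : ℝ => (r ^ 2 + y ^ 2)⁻¹ := by
  refine ((integrable_inv_one_add_sq.comp_div hr.ne').const_mul (r ^ 2)⁻¹).congr
    (Eventually.of_forall fun y => ?_)
  simp only
  rw [← mul_inv]
  field_simp

theorem integral_inv_sq_add_sq {r : ℝ} (hr : 0 < r) :
    ∫ y : ℝ, (r ^ 2 + y ^ 2)⁻¹ = Real.pi / r := by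
  have h (y : ℝ) : (r ^ 2 + y ^ 2)⁻¹ = (r ^ 2)⁻¹ * (1 + (y / r) ^ 2)⁻¹ := by
    rw [← mul_inv]
    field_simp
  simp_rw [h]
  rw [integral_const_mul, Measure.integral_comp_div (fun y : ℝ => (1 + y ^ 2)⁻¹),
    integral_univ_inv_one_add_sq, abs_of_pos hr, smul_eq_mul]
  field_simp

/-- The kernel `c^{-z-1/2} / (z + 1/2)`, on the imaginary axis a multiple of the conjugate of the
modified Mellin transform of `highPow (-1) c`. -/
def tailKernel (c : ℝ) (z : ℂ) : ℂ := (c : ℂ) ^ (-z - 1 / 2) / (z + 1 / 2)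

theorem differentiableAt_tailKernel {c : ℝ} (hc : 0 < c) {z : ℂ} (hz : 0 ≤ z.re) :
    DifferentiableAt ℂ (tailKernel c) z := by
  have hc0 : (c : ℂ) ≠ 0 := by exact_mod_cast hc.ne'
  unfold tailKernel
  exact DifferentiableAt.div (DifferentiableAt.const_cpow (by fun_prop) (Or.inl hc0))
    (by fun_prop) (add_half_ne_zero hz)

theorem continuous_tailKernel {c : ℝ} (hc : 0 < c) {x : ℝ} (hx : 0 ≤ x) :
    Continuous fun y : ℝ => tailKernel c ((x : ℂ) + (y : ℂ) * Complex.I) :=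
  continuous_iff_continuousAt.2 fun y =>
    (differentiableAt_tailKernel hc (by simpa using hx)).continuousAt.comp
      (f := fun y : ℝ => (x : ℂ) + (y : ℂ) * Complex.I) (by fun_prop)

theorem norm_tailKernel_sq_le {c : ℝ} (hc : 1 ≤ c) {x : ℝ} (hx : 0 ≤ x) (y : ℝ) :
    ‖tailKernel c ((x : ℂ) + (y : ℂ) * Complex.I)‖ ^ 2 ≤ ((x + 1 / 2) ^ 2 + y ^ 2)⁻¹ := by
  have hnum : ‖(c : ℂ) ^ (-((x : ℂ) + (y : ℂ) * Complex.I) - 1 / 2)‖ ≤ 1 := by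
    rw [Complex.norm_cpow_eq_rpow_re_of_pos (one_pos.trans_le hc)]
    refine Real.rpow_le_one_of_one_le_of_nonpos hc ?_
    norm_num
    linarith
  have hden : ‖(x : ℂ) + (y : ℂ) * Complex.I + 1 / 2‖ ^ 2 = (x + 1 / 2) ^ 2 + y ^ 2 := by
    rw [← Complex.normSq_eq_norm_sq, Complex.normSq_apply]
    norm_num
    ring
  rw [tailKernel, norm_div, div_pow, hden, div_eq_mul_inv]
  exact mul_le_of_le_one_left (by positivity) (pow_le_one₀ (norm_nonneg _) hnum)

theorem eLpNorm_tailKernel_le {c : ℝ} (hc : 1 ≤ c) {x : ℝ} (hx : 0 ≤ x) :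
    eLpNorm (fun y : ℝ => tailKernel c ((x : ℂ) + (y : ℂ) * Complex.I)) 2 volume ≤
      ENNReal.ofReal (Real.pi / (x + 1 / 2)) ^ (1 / 2 : ℝ) := by
  have hx' : 0 < x + 1 / 2 := by positivity
  rw [eLpNorm_two_eq_lintegral]
  refine ENNReal.rpow_le_rpow ?_ one_half_pos.le
  rw [← integral_inv_sq_add_sq hx', ofReal_integral_eq_lintegral_ofReal
    (integrable_inv_sq_add_sq hx') (Eventually.of_forall fun y => by positivity)]
  refine lintegral_mono fun y => ?_
  rw [← ofReal_norm, ← ENNReal.ofReal_pow (norm_nonneg _)]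
  exact ENNReal.ofReal_le_ofReal (norm_tailKernel_sq_le hc hx y)

theorem memLp_tailKernel {c : ℝ} (hc : 1 ≤ c) :
    MemLp (fun y : ℝ => tailKernel c ((y : ℂ) * Complex.I)) 2 volume := by
  have h : MemLp (fun y : ℝ => tailKernel c (((0 : ℝ) : ℂ) + (y : ℂ) * Complex.I)) 2 volume :=
    ⟨(continuous_tailKernel (one_pos.trans_le hc) le_rfl).aestronglyMeasurable,
      (eLpNorm_tailKernel_le hc le_rfl).trans_lt
        (ENNReal.rpow_lt_top_of_nonneg one_half_pos.le ENNReal.ofReal_ne_top)⟩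
  simpa using h

theorem tendsto_ofReal_pi_div_atTop :
    Tendsto (fun x : ℝ => ENNReal.ofReal (Real.pi / (x + 1 / 2)) ^ (1 / 2 : ℝ)) atTop (𝓝 0) := by
  have h := (tendsto_atTop_add_const_right atTop (1 / 2 : ℝ) tendsto_id).const_div_atTop Real.pi
  simpa using (ENNReal.tendsto_ofReal h).ennrpow_const (1 / 2 : ℝ)

theorem IsHardyFunction.continuous_vertical {F : ℂ → ℂ} (hF : IsHardyFunction F) {x : ℝ}
    (hx : 0 < x) : Continuous fun y : ℝ => F ((x : ℂ) + (y : ℂ) * Complex.I) :=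
  hF.1.continuousOn.comp_continuous (by fun_prop) fun y => by simpa using hx

theorem IsHardyFunction.exists_eLpNorm_le {F : ℂ → ℂ} (hF : IsHardyFunction F) :
    ∃ C : NNReal, ∀ x : ℝ, 0 < x →
      eLpNorm (fun y : ℝ => F ((x : ℂ) + (y : ℂ) * Complex.I)) 2 volume ≤ C := by
  refine ⟨((⨆ (x : ℝ) (_ : 0 < x),
    ∫⁻ y : ℝ, ‖F ((x : ℂ) + (y : ℂ) * Complex.I)‖ₑ ^ 2) ^ (1 / 2 : ℝ)).toNNReal, fun x hx => ?_⟩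
  rw [ENNReal.coe_toNNReal (ENNReal.rpow_lt_top_of_nonneg one_half_pos.le hF.2.ne).ne,
    eLpNorm_two_eq_lintegral]
  exact ENNReal.rpow_le_rpow (le_iSup₂ (f := fun (x : ℝ) (_ : 0 < x) =>
    ∫⁻ y : ℝ, ‖F ((x : ℂ) + (y : ℂ) * Complex.I)‖ₑ ^ 2) x hx) one_half_pos.le

theorem IsHardyFunction.exists_lintegral_mul_tailKernel_le {F : ℂ → ℂ} (hF : IsHardyFunction F) :
    ∃ C : NNReal, ∀ c : ℝ, 1 ≤ c → ∀ ε : ℝ, 0 < ε → ∀ x : ℝ, 0 ≤ x →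
      ∫⁻ y : ℝ, ‖F ((ε : ℂ) + ((x : ℂ) + (y : ℂ) * Complex.I)) *
        tailKernel c ((x : ℂ) + (y : ℂ) * Complex.I)‖ₑ ≤
          C * ENNReal.ofReal (Real.pi / (x + 1 / 2)) ^ (1 / 2 : ℝ) := by
  obtain ⟨C, hC⟩ := hF.exists_eLpNorm_le
  refine ⟨C, fun c hc ε hε x hx => ?_⟩
  have hεx : 0 < ε + x := add_pos_of_pos_of_nonneg hε hx
  have hholder := eLpNorm_indicator_mul_le (hF.continuous_vertical hεx).aestronglyMeasurable
    (continuous_tailKernel (one_pos.trans_le hc) hx).aestronglyMeasurable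
    (μ := volume) MeasurableSet.univ
  simp only [indicator_univ, Complex.ofReal_add, add_assoc] at hholder
  rw [← eLpNorm_one_eq_lintegral_enorm]
  refine hholder.trans (mul_le_mul' ?_ (eLpNorm_tailKernel_le hc hx))
  simpa only [Complex.ofReal_add, add_assoc] using hC _ hεx

theorem IsHardyFunction.integral_mul_tailKernel_eq_zero {F : ℂ → ℂ} (hF : IsHardyFunction F)
    {c : ℝ} (hc : 1 ≤ c) {ε : ℝ} (hε : 0 < ε) :
    ∫ y : ℝ, F ((ε : ℂ) + (y : ℂ) * Complex.I) * tailKernel c ((y : ℂ) * Complex.I) = 0 := by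
  obtain ⟨C, hC⟩ := hF.exists_lintegral_mul_tailKernel_le
  let G : ℂ → ℂ := fun z => F (ε + z) * tailKernel c z
  let D : ℝ → ℝ≥0∞ := fun x => C * ENNReal.ofReal (Real.pi / (x + 1 / 2)) ^ (1 / 2 : ℝ)
  have hG {x : ℝ} (hx : 0 ≤ x) : ∫⁻ y : ℝ, ‖G ((x : ℂ) + (y : ℂ) * Complex.I)‖ₑ ≤ D x :=
    hC c hc ε hε x hx
  have hshift {x : ℝ} (hx : 0 ≤ x) :
      ∫ y : ℝ, G (((0 : ℝ) : ℂ) + (y : ℂ) * Complex.I) =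
        ∫ y : ℝ, G ((x : ℂ) + (y : ℂ) * Complex.I) := by
    refine integral_vertical_eq (B := D 0) hx (fun z hz => ?_)
      (ENNReal.mul_ne_top ENNReal.coe_ne_top (by finiteness)) fun u hu => (hG hu.1).trans ?_
    · have hre : 0 < ((ε : ℂ) + z).re := by simpa using add_pos_of_pos_of_nonneg hε hz.1
      have hFz : DifferentiableAt ℂ F (ε + z) :=
        hF.1.differentiableAt ((isOpen_lt continuous_const Complex.continuous_re).mem_nhds hre)
      exact ((hFz.comp z (by fun_prop : DifferentiableAt ℂ (fun z => (ε : ℂ) + z) z)).mul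
        (differentiableAt_tailKernel (one_pos.trans_le hc) hz.1)).differentiableWithinAt
    · have := hu.1
      simp only [D]
      gcongr
  have hlim : Tendsto D atTop (𝓝 0) := by
    simpa only [mul_zero] using ENNReal.Tendsto.const_mul tendsto_ofReal_pi_div_atTop
      (Or.inr ENNReal.coe_ne_top : (0 : ℝ≥0∞) ≠ 0 ∨ (C : ℝ≥0∞) ≠ ∞)
  have hle : ‖∫ y : ℝ, G (((0 : ℝ) : ℂ) + (y : ℂ) * Complex.I)‖ₑ ≤ 0 := by
    refine ge_of_tendsto hlim ?_
    filter_upwards [eventually_ge_atTop 0] with x hx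
    rw [hshift hx]
    exact (enorm_integral_le_lintegral_enorm _).trans (hG hx)
  simpa [G] using hle

theorem IsHardyFunction.integral_boundary_mul_tailKernel {F : ℂ → ℂ} (hF : IsHardyFunction F)
    {g : ℝ → ℂ} (hg : MemLp g 2 volume)
    (hlim : ∀ᵐ y : ℝ, Tendsto (fun x : ℝ => F ((x : ℂ) + (y : ℂ) * Complex.I)) (𝓝[>] 0) (𝓝 (g y)))
    {c : ℝ} (hc : 1 ≤ c) :
    ∫ y : ℝ, g y * tailKernel c ((y : ℂ) * Complex.I) = 0 := by
  obtain ⟨C, hC⟩ := hF.exists_eLpNorm_le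
  let ε : ℕ → ℝ := fun n => 1 / ((n : ℝ) + 1)
  have hpos (n : ℕ) : 0 < ε n := Nat.one_div_pos_of_nat
  have hε : Tendsto ε atTop (𝓝[>] 0) :=
    tendsto_nhdsWithin_iff.2 ⟨tendsto_one_div_add_atTop_nhds_zero_nat, Eventually.of_forall hpos⟩
  have hconv := tendsto_integral_mul_of_ae_tendsto
    (fun n => (hF.continuous_vertical (hpos n)).aestronglyMeasurable) (fun n => hC _ (hpos n))
    hg (memLp_tailKernel hc) (hlim.mono fun y hy => hy.comp hε)
  simp only [hF.integral_mul_tailKernel_eq_zero hc (hpos _)] at hconv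
  exact tendsto_nhds_unique hconv tendsto_const_nhds

theorem inner_highPow_eq_integral_tailKernel {c : ℝ} (hc : 0 < c) (f : L2Inf) :
    inner ℂ (highPow (-1) (by norm_num) c hc) f =
      ((√(2 * Real.pi) : ℝ) : ℂ)⁻¹ *
        ∫ y : ℝ, mellinIso f ((y : ℂ) * Complex.I) * tailKernel c ((y : ℂ) * Complex.I) := by
  rw [← mellinIso.inner_map_map, L2.inner_def, integral_imagAxis, ← integral_const_mul]
  refine integral_congr_ae ?_
  filter_upwards [ae_imagAxis_iff.1 (mellinIso_highPow (a := -1) (by norm_num) hc)] with y hy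
  have hexp : (y : ℂ) * Complex.I + 1 / 2 + -1 = y * Complex.I - 1 / 2 := by ring
  have hconj : starRingEnd ℂ ((y : ℂ) * Complex.I - 1 / 2) = -(y * Complex.I) - 1 / 2 := by
    rw [map_sub, map_mul, Complex.conj_ofReal, Complex.conj_I, map_div₀, map_one, map_ofNat,
      mul_neg]
  rw [hy, hexp, RCLike.inner_apply, map_mul, map_inv₀, Complex.conj_ofReal, map_neg, map_div₀,
    conj_cpow_of_pos hc, hconj, tailKernel, ← neg_add', div_neg, neg_neg]
  ring

theorem exists_extendZero_eq {f : L2Inf} (hf : ∀ᵐ t : ℝ, 1 < t → f t = 0) :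
    ∃ h : L2One, extendZero h = f := by
  refine ⟨(memLp_restrict_Ioo f).toLp f, Lp.ext ?_⟩
  refine (extendZero_ae_eq _).trans
    ((extend_congr (memLp_restrict_Ioo f).coeFn_toLp).trans ?_)
  rw [EventuallyEq, ae_restrict_iff' measurableSet_Ioi]
  filter_upwards [hf, Measure.ae_ne volume 1] with t ht hne hpos
  refine indicator_apply_eq_self.2 fun hmem => ht ?_
  exact (not_lt.1 fun h => hmem ⟨hpos, h⟩).lt_of_ne' hne

theorem exists_mellinIso_extendZero_eq {g : L2Imag} (hg : g ∈ hardyPlus) :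
    ∃ f : L2One, mellinIso (extendZero f) = g := by
  obtain ⟨F, hF, hlim⟩ := hg
  obtain ⟨f, rfl⟩ := mellinIso.surjective g
  have hmem : MemLp (fun y : ℝ => mellinIso f ((y : ℂ) * Complex.I)) 2 volume :=
    (Lp.memLp _).comp_measurePreserving measurePreserving_toImag
  have hzero : ∀ᵐ t : ℝ, 1 < t → f t = 0 :=
    ae_eq_zero_of_inner_highPow (a := -1) (by norm_num) one_pos fun c hc => by
      rw [inner_highPow_eq_integral_tailKernel,
        hF.integral_boundary_mul_tailKernel hmem (ae_imagAxis_iff.1 hlim) hc, mul_zero]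
  obtain ⟨h, rfl⟩ := exists_extendZero_eq hzero
  exact ⟨h, rfl⟩

/-! ### Almost everywhere convergence of Poisson integrals -/

section LayerCake

/-- The density in the layer-cake formula `(1 + v²)⁻¹ = ∫ r in Ioi |v|, layer r` for the Poisson
kernel. -/
def layer (r : ℝ) : ℝ := 2 * r / (1 + r ^ 2) ^ 2

theorem layer_nonneg {r : ℝ} (hr : 0 ≤ r) : 0 ≤ layer r := by
  unfold layer
  positivity

theorem measurable_layer : Measurable layer := by
  unfold layer
  fun_prop

theorem layer_mul_le (r : ℝ) : layer r * r ≤ 2 * (1 + r ^ 2)⁻¹ := by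
  rw [layer, div_mul_eq_mul_div, ← div_eq_mul_inv, div_le_div_iff₀ (by positivity) (by positivity)]
  nlinarith [sq_nonneg r, sq_nonneg (r ^ 2)]

theorem hasDerivAt_neg_inv_one_add_sq (r : ℝ) :
    HasDerivAt (fun r : ℝ => -(1 + r ^ 2)⁻¹) (layer r) r := by
  have h : HasDerivAt (fun r : ℝ => 1 + r ^ 2) (2 * r) r := by
    simpa using (hasDerivAt_pow 2 r).const_add 1
  refine (h.inv (by positivity)).neg.congr_deriv ?_
  rw [layer]
  ring

theorem tendsto_neg_inv_one_add_sq : Tendsto (fun r : ℝ => -(1 + r ^ 2)⁻¹) atTop (𝓝 0) := by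
  simpa using (tendsto_inv_atTop_zero.comp
    (tendsto_atTop_add_const_left _ (1 : ℝ) (tendsto_pow_atTop two_ne_zero))).neg

theorem integrableOn_layer {a : ℝ} (ha : 0 ≤ a) : IntegrableOn layer (Ioi a) :=
  integrableOn_Ioi_deriv_of_nonneg' (fun r _ => hasDerivAt_neg_inv_one_add_sq r)
    (fun _ hr => layer_nonneg (ha.trans (le_of_lt hr))) tendsto_neg_inv_one_add_sq

theorem integral_layer (v : ℝ) : ∫ r in Ioi |v|, layer r = (1 + v ^ 2)⁻¹ := by
  rw [integral_Ioi_of_hasDerivAt_of_tendsto' (fun r _ => hasDerivAt_neg_inv_one_add_sq r)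
    (integrableOn_layer (abs_nonneg v)) tendsto_neg_inv_one_add_sq, sq_abs, zero_sub, neg_neg]

variable {E : Type*} [NormedAddCommGroup E] [NormedSpace ℝ E] {h : ℝ → E}

theorem aestronglyMeasurable_of_poisson (hh : Integrable fun v => (1 + v ^ 2)⁻¹ • h v) :
    AEStronglyMeasurable h volume := by
  refine ((by fun_prop : Continuous fun v : ℝ => 1 + v ^ 2).aestronglyMeasurable.smul
    hh.aestronglyMeasurable).congr (Eventually.of_forall fun v => ?_)
  exact smul_inv_smul₀ (by positivity : (1 + v ^ 2 : ℝ) ≠ 0) _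

theorem integrable_layer_indicator (hh : Integrable fun v => (1 + v ^ 2)⁻¹ • h v) :
    Integrable (Function.uncurry fun v r => (Ioi |v|).indicator (fun r => layer r • h v) r)
      (volume.prod (volume.restrict (Ioi 0))) := by
  have hsub (v : ℝ) : Ioi |v| ⊆ Ioi 0 := Ioi_subset_Ioi (abs_nonneg v)
  have hmeas : AEStronglyMeasurable
      (Function.uncurry fun v r => (Ioi |v|).indicator (fun r => layer r • h v) r)
      (volume.prod (volume.restrict (Ioi 0))) :=
    ((measurable_layer.comp measurable_snd).aestronglyMeasurable.smul
      (aestronglyMeasurable_of_poisson hh).comp_fst).indicator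
        (measurableSet_lt (by fun_prop) (by fun_prop) : MeasurableSet {p : ℝ × ℝ | |p.1| < p.2})
  refine (integrable_prod_iff hmeas).2 ⟨Eventually.of_forall fun v => ?_, ?_⟩
  · exact ((integrable_indicator_iff measurableSet_Ioi).2
      ((integrableOn_layer (abs_nonneg v)).smul_const (h v))).integrableOn
  · refine hh.norm.congr (Eventually.of_forall fun v => ?_)
    simp only [Function.uncurry_apply_pair, norm_indicator_eq_indicator_norm, norm_smul]
    rw [setIntegral_indicator measurableSet_Ioi, inter_eq_right.2 (hsub v), integral_mul_const,
      ← integral_layer v, Real.norm_of_nonneg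
        (setIntegral_nonneg measurableSet_Ioi fun r hr => layer_nonneg (hsub v hr).le)]
    congr 1
    exact setIntegral_congr_fun measurableSet_Ioi fun r hr =>
      (Real.norm_of_nonneg (layer_nonneg (hsub v hr).le)).symm

theorem integral_poisson_eq_layer [CompleteSpace E]
    (hh : Integrable fun v => (1 + v ^ 2)⁻¹ • h v) :
    ∫ v, (1 + v ^ 2)⁻¹ • h v = ∫ r in Ioi (0 : ℝ), layer r • ∫ v in (-r)..r, h v := by
  have hrow (v : ℝ) : ∫ r in Ioi 0, (Ioi |v|).indicator (fun r => layer r • h v) r =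
      (1 + v ^ 2)⁻¹ • h v := by
    rw [setIntegral_indicator measurableSet_Ioi,
      inter_eq_right.2 (Ioi_subset_Ioi (abs_nonneg v)), integral_smul_const, integral_layer]
  have hcol (r : ℝ) (hr : r ∈ Ioi 0) :
      ∫ v, (Ioi |v|).indicator (fun r => layer r • h v) r = layer r • ∫ v in (-r)..r, h v := by
    have hind : (fun v => (Ioi |v|).indicator (fun r => layer r • h v) r) =
        (Ioo (-r) r).indicator fun v => layer r • h v := by
      funext v
      simp only [indicator, mem_Ioi, mem_Ioo, abs_lt]
    rw [hind, integral_indicator measurableSet_Ioo, integral_smul,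
      intervalIntegral.integral_of_le (neg_le_self (le_of_lt hr)), integral_Ioc_eq_integral_Ioo]
  rw [← setIntegral_congr_fun measurableSet_Ioi hcol,
    ← integral_integral_swap (integrable_layer_indicator hh)]
  simp_rw [hrow]

theorem integral_layer_mul_two_mul : ∫ r in Ioi (0 : ℝ), layer r * (2 * r) = Real.pi := by
  have h := integral_poisson_eq_layer (h := fun _ : ℝ => (1 : ℝ))
    (by simpa using integrable_inv_one_add_sq)
  simp only [smul_eq_mul, mul_one, integral_univ_inv_one_add_sq, intervalIntegral.integral_const,
    sub_neg_eq_add, ← two_mul] at h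
  exact h.symm

end LayerCake

theorem memLp_comp_affine {E : Type*} [NormedAddCommGroup E] {g : ℝ → E} {p : ℝ≥0∞}
    (hg : MemLp g p volume) (β : ℝ) {x : ℝ} (hx : x ≠ 0) :
    MemLp (fun v => g (β + x * v)) p volume := by
  have hshift := hg.comp_measurePreserving (measurePreserving_add_left volume β)
  have hscale : MemLp (fun y => g (β + y)) p (Measure.map (fun v => x * v) volume) := by
    rw [Real.map_volume_mul_left hx]
    exact hshift.smul_measure ENNReal.ofReal_ne_top
  exact hscale.comp_of_map (by fun_prop)

theorem memLp_inv_one_add_sq : MemLp (fun v : ℝ => (1 + v ^ 2)⁻¹) 2 volume := by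
  have hcont : Continuous fun v : ℝ => (1 + v ^ 2)⁻¹ :=
    Continuous.inv₀ (by fun_prop) fun v => by positivity
  rw [memLp_two_iff_integrable_sq hcont.aestronglyMeasurable]
  refine integrable_inv_one_add_sq.mono' (hcont.pow 2).aestronglyMeasurable
    (Eventually.of_forall fun v => ?_)
  have hle : (1 + v ^ 2)⁻¹ ≤ 1 := inv_le_one_of_one_le₀ (by nlinarith [sq_nonneg v])
  rw [Real.norm_of_nonneg (by positivity)]
  exact pow_le_of_le_one (by positivity) hle two_ne_zero

section Poisson

variable {E : Type*} [NormedAddCommGroup E] [NormedSpace ℝ E] {g : ℝ → E} {β : ℝ}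

theorem norm_intervalIntegral_le_of_memLp_two (hg : MemLp g 2 volume) (a b : ℝ) :
    ‖∫ t in a..b, g t‖ ≤ |b - a| + ∫ t, ‖g t‖ ^ 2 := by
  have hsq : Integrable fun t => ‖g t‖ ^ 2 := (memLp_two_iff_integrable_sq_norm hg.1).1 hg
  have hone : IntegrableOn (fun _ => (1 : ℝ)) (uIoc a b) := by simp [uIoc]
  calc ‖∫ t in a..b, g t‖ ≤ ∫ t in uIoc a b, ‖g t‖ :=
        intervalIntegral.norm_integral_le_integral_norm_uIoc
    _ ≤ ∫ t in uIoc a b, (1 + ‖g t‖ ^ 2) := by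
        refine integral_mono_of_nonneg (Eventually.of_forall fun _ => norm_nonneg _)
          (hone.add hsq.integrableOn) (Eventually.of_forall fun t => ?_)
        exact le_of_sub_nonneg (by nlinarith [sq_nonneg (‖g t‖ - 1)])
    _ = |b - a| + ∫ t in uIoc a b, ‖g t‖ ^ 2 := by
        rw [integral_add hone hsq.integrableOn]
        simp [Measure.real, Real.volume_uIoc]
    _ ≤ |b - a| + ∫ t, ‖g t‖ ^ 2 := by
        exact add_le_add_right (setIntegral_le_integral hsq
          (Eventually.of_forall fun _ => by positivity)) _

theorem exists_norm_intervalIntegral_le (hg : MemLp g 2 volume) {g' : E}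
    (hβ : HasDerivAt (fun x => ∫ t in β..x, g t) g' β) :
    ∃ C : ℝ, 0 ≤ C ∧ ∀ x, ‖∫ t in β..x, g t‖ ≤ C * |x - β| := by
  obtain ⟨C, hC⟩ := hβ.isBigO_sub.bound
  obtain ⟨δ, hδ, hball⟩ := Metric.eventually_nhds_iff.1 hC
  have : 0 ≤ ∫ t, ‖g t‖ ^ 2 := integral_nonneg fun _ => by positivity
  refine ⟨max C (1 + (∫ t, ‖g t‖ ^ 2) / δ), le_max_of_le_right (by positivity), fun x => ?_⟩
  rcases lt_or_ge |x - β| δ with hx | hx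
  · have hnear := hball (Real.dist_eq x β ▸ hx)
    rw [intervalIntegral.integral_same, sub_zero, Real.norm_eq_abs] at hnear
    exact hnear.trans (by gcongr; exact le_max_left _ _)
  · calc ‖∫ t in β..x, g t‖ ≤ |x - β| + (∫ t, ‖g t‖ ^ 2) / δ * δ := by
          rw [div_mul_cancel₀ _ hδ.ne']
          exact norm_intervalIntegral_le_of_memLp_two hg β x
      _ ≤ |x - β| + (∫ t, ‖g t‖ ^ 2) / δ * |x - β| := by gcongr
      _ = (1 + (∫ t, ‖g t‖ ^ 2) / δ) * |x - β| := by ring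
      _ ≤ _ := by gcongr; exact le_max_right _ _

theorem intervalIntegral_comp_affine_eq (hloc : LocallyIntegrable g volume) {x : ℝ} (hx : x ≠ 0)
    (r : ℝ) : ∫ v in (-r)..r, g (β + x * v) =
      x⁻¹ • ((∫ t in β..(β + x * r), g t) - ∫ t in β..(β + x * -r), g t) := by
  have hint (a b : ℝ) : IntervalIntegrable g volume a b :=
    (hloc.integrableOn_isCompact isCompact_uIcc).intervalIntegrable
  rw [intervalIntegral.integral_comp_add_mul g hx β,
    intervalIntegral.integral_interval_sub_left (hint _ _) (hint _ _)]

theorem tendsto_intervalIntegral_comp_affine (hloc : LocallyIntegrable g volume)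
    (hβ : HasDerivAt (fun x => ∫ t in β..x, g t) (g β) β) (r : ℝ) :
    Tendsto (fun x : ℝ => ∫ v in (-r)..r, g (β + x * v)) (𝓝[>] 0) (𝓝 ((2 * r) • g β)) := by
  have hline (r : ℝ) : HasDerivAt (fun x : ℝ => ∫ t in β..(β + x * r), g t) (r • g β) 0 := by
    have hinner : HasDerivAt (fun x : ℝ => β + x * r) r 0 := by
      simpa using ((hasDerivAt_id (0 : ℝ)).mul_const r).const_add β
    exact HasDerivAt.scomp (0 : ℝ) (by simpa using hβ) hinner
  have hslope := ((hline r).sub (hline (-r))).tendsto_slope_zero_right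
  rw [← sub_smul, sub_neg_eq_add, ← two_mul] at hslope
  refine hslope.congr' ?_
  filter_upwards [self_mem_nhdsWithin] with x hx
  rw [intervalIntegral_comp_affine_eq hloc (ne_of_gt hx)]
  simp

theorem norm_intervalIntegral_comp_affine_le (hloc : LocallyIntegrable g volume) {C : ℝ}
    (hC : ∀ x, ‖∫ t in β..x, g t‖ ≤ C * |x - β|) {x r : ℝ} (hx : 0 < x) (hr : 0 ≤ r) :
    ‖∫ v in (-r)..r, g (β + x * v)‖ ≤ 2 * C * r := by
  have hplus := hC (β + x * r)
  have hminus := hC (β + x * -r)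
  rw [add_sub_cancel_left, abs_of_nonneg (by positivity)] at hplus
  rw [add_sub_cancel_left, mul_neg, abs_neg, abs_of_nonneg (by positivity)] at hminus
  rw [intervalIntegral_comp_affine_eq hloc hx.ne', norm_smul, norm_inv, Real.norm_of_nonneg hx.le]
  calc x⁻¹ * ‖(∫ t in β..(β + x * r), g t) - ∫ t in β..(β + x * -r), g t‖
      ≤ x⁻¹ * (C * (x * r) + C * (x * r)) := by
        gcongr
        exact (norm_sub_le _ _).trans (add_le_add hplus (by rwa [mul_neg]))
    _ = 2 * C * r := by
        field_simp
        ring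

theorem integral_poisson_rescale (g : ℝ → E) (β : ℝ) {x : ℝ} (hx : 0 < x) :
    ∫ y, (x / (x ^ 2 + (y - β) ^ 2)) • g y = ∫ v, (1 + v ^ 2)⁻¹ • g (β + x * v) := by
  let G : ℝ → E := fun y => (x / (x ^ 2 + (y - β) ^ 2)) • g y
  have hG (v : ℝ) : (1 + v ^ 2)⁻¹ • g (β + x * v) = x • G (β + x * v) := by
    simp only [G]
    rw [add_sub_cancel_left, smul_smul]
    congr 1
    field_simp
  simp_rw [hG]
  rw [integral_smul, Measure.integral_comp_mul_left (fun y => G (β + y)) x,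
    integral_add_left_eq_self G β, abs_of_pos (inv_pos.2 hx), smul_inv_smul₀ hx.ne']

variable [CompleteSpace E]

theorem tendsto_integral_layer_smul (hg : MemLp g 2 volume)
    (hβ : HasDerivAt (fun x => ∫ t in β..x, g t) (g β) β) :
    Tendsto (fun x : ℝ => ∫ r in Ioi (0 : ℝ), layer r • ∫ v in (-r)..r, g (β + x * v)) (𝓝[>] 0)
      (𝓝 (Real.pi • g β)) := by
  have hloc : LocallyIntegrable g volume := hg.locallyIntegrable one_le_two
  obtain ⟨C, hC0, hC⟩ := exists_norm_intervalIntegral_le hg hβ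
  have hlimit : ∫ r in Ioi (0 : ℝ), layer r • (2 * r) • g β = Real.pi • g β := by
    simp_rw [smul_smul]
    rw [integral_smul_const, integral_layer_mul_two_mul]
  rw [← hlimit]
  refine tendsto_integral_filter_of_dominated_convergence (fun r => 4 * C * (1 + r ^ 2)⁻¹) ?_ ?_
    (integrable_inv_one_add_sq.const_mul _).integrableOn (Eventually.of_forall fun r =>
      (tendsto_intervalIntegral_comp_affine hloc hβ r).const_smul _)
  · filter_upwards [self_mem_nhdsWithin] with x hx
    have hint (a b : ℝ) : IntervalIntegrable (fun v => g (β + x * v)) volume a b :=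
      (((memLp_comp_affine hg β (ne_of_gt hx)).locallyIntegrable one_le_two).integrableOn_isCompact
        isCompact_uIcc).intervalIntegrable
    have hcont : Continuous fun r : ℝ => ∫ v in (-r)..r, g (β + x * v) := by
      have hprim := intervalIntegral.continuous_primitive hint 0
      exact (hprim.sub (hprim.comp continuous_neg)).congr fun r =>
        intervalIntegral.integral_interval_sub_left (hint _ _) (hint _ _)
    exact measurable_layer.aestronglyMeasurable.smul hcont.aestronglyMeasurable
  · filter_upwards [self_mem_nhdsWithin] with x hx
    filter_upwards [ae_restrict_mem measurableSet_Ioi] with r hr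
    have hr : 0 ≤ r := le_of_lt hr
    rw [norm_smul, Real.norm_of_nonneg (layer_nonneg hr)]
    calc layer r * ‖∫ v in (-r)..r, g (β + x * v)‖ ≤ layer r * (2 * C * r) :=
          mul_le_mul_of_nonneg_left (norm_intervalIntegral_comp_affine_le hloc hC hx hr)
            (layer_nonneg hr)
      _ = 2 * C * (layer r * r) := by ring
      _ ≤ 2 * C * (2 * (1 + r ^ 2)⁻¹) := mul_le_mul_of_nonneg_left (layer_mul_le r) (by positivity)
      _ = 4 * C * (1 + r ^ 2)⁻¹ := by ring

theorem ae_tendsto_poisson (hg : MemLp g 2 volume) :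
    ∀ᵐ β : ℝ, Tendsto (fun x : ℝ => Real.pi⁻¹ • ∫ y, (x / (x ^ 2 + (y - β) ^ 2)) • g y)
      (𝓝[>] 0) (𝓝 (g β)) := by
  filter_upwards [LocallyIntegrable.ae_hasDerivAt_integral (hg.locallyIntegrable one_le_two)]
    with β hβ
  have hlim := (tendsto_integral_layer_smul hg (hβ β)).const_smul Real.pi⁻¹
  rw [inv_smul_smul₀ Real.pi_ne_zero] at hlim
  refine hlim.congr' ?_
  filter_upwards [self_mem_nhdsWithin] with x hx
  rw [integral_poisson_rescale g β hx, integral_poisson_eq_layer]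
  exact memLp_one_iff_integrable.1 ((memLp_comp_affine hg β (ne_of_gt hx)).smul
    memLp_inv_one_add_sq)

end Poisson

/-! ### Mellin transforms of functions supported in `(0, 1]` -/

section UnitSupport

variable {E : Type*} [NormedAddCommGroup E] [NormedSpace ℂ E] {f : ℝ → E} {σ s : ℂ}

theorem aestronglyMeasurable_cpow_smul (hσ : MellinConvergent f σ) (s : ℂ) :
    AEStronglyMeasurable (fun t : ℝ => (t : ℂ) ^ (s - 1) • f t) (volume.restrict (Ioi 0)) := by
  have hcpow : Measurable fun t : ℝ => (t : ℂ) ^ (s - σ) := Complex.measurable_ofReal.pow_const _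
  refine (hcpow.aestronglyMeasurable.smul hσ.aestronglyMeasurable).congr ?_
  filter_upwards [ae_restrict_mem measurableSet_Ioi] with t ht
  have ht0 : (t : ℂ) ≠ 0 := by exact_mod_cast (ne_of_gt ht : t ≠ 0)
  rw [Pi.smul_apply', smul_smul, ← Complex.cpow_add _ _ ht0, sub_add_sub_cancel]

theorem mellinConvergent_of_re_le (hf : ∀ t, 1 < t → f t = 0) (hσ : MellinConvergent f σ)
    (h : σ.re ≤ s.re) : MellinConvergent f s := by
  refine Integrable.mono hσ (aestronglyMeasurable_cpow_smul hσ s) ?_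
  filter_upwards [ae_restrict_mem measurableSet_Ioi] with t ht
  rcases lt_or_ge 1 t with h1 | h1
  · simp [hf t h1]
  · rw [norm_smul, norm_smul, Complex.norm_cpow_eq_rpow_re_of_pos ht,
      Complex.norm_cpow_eq_rpow_re_of_pos ht]
    gcongr ?_ * _
    exact Real.rpow_le_rpow_of_exponent_ge ht h1 (by simpa using h)

theorem norm_cpow_mul_log_le {t : ℝ} (ht : 0 < t) (ht1 : t ≤ 1) {δ : ℝ} (hδ : 0 < δ)
    (h : σ.re + δ ≤ s.re) :
    ‖(t : ℂ) ^ (s - 1) * Complex.log (t : ℂ)‖ ≤ δ⁻¹ * ‖(t : ℂ) ^ (σ - 1)‖ := by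
  rw [norm_mul, Complex.norm_cpow_eq_rpow_re_of_pos ht, Complex.norm_cpow_eq_rpow_re_of_pos ht,
    ← Complex.ofReal_log ht.le, Complex.norm_real, Real.norm_eq_abs]
  calc t ^ (s - 1).re * |Real.log t|
      ≤ t ^ ((σ - 1).re + δ) * |Real.log t| := by
        gcongr ?_ * _
        refine Real.rpow_le_rpow_of_exponent_ge ht ht1 ?_
        rw [Complex.sub_re, Complex.sub_re]
        linarith
    _ = t ^ (σ - 1).re * |Real.log t * t ^ δ| := by
        rw [Real.rpow_add ht, abs_mul, abs_of_pos (Real.rpow_pos_of_pos ht δ)]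
        ring
    _ ≤ t ^ (σ - 1).re * δ⁻¹ := by
        gcongr
        exact (one_div δ ▸ Real.abs_log_mul_self_rpow_lt t δ ht ht1 hδ).le
    _ = δ⁻¹ * t ^ (σ - 1).re := mul_comm _ _

theorem differentiableAt_mellin (hf : ∀ t, 1 < t → f t = 0) (hσ : MellinConvergent f σ)
    (h : σ.re < s.re) : DifferentiableAt ℂ (mellin f) s := by
  obtain ⟨δ, hδ, hδs⟩ : ∃ δ : ℝ, 0 < δ ∧ σ.re + δ + δ = s.re :=
    ⟨(s.re - σ.re) / 2, by linarith, by ring⟩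
  have hlog : Measurable fun t : ℝ => Complex.log (t : ℂ) :=
    Complex.measurable_log.comp Complex.measurable_ofReal
  refine (hasDerivAt_integral_of_dominated_loc_of_deriv_le (μ := volume.restrict (Ioi 0))
    (F := fun z (t : ℝ) => (t : ℂ) ^ (z - 1) • f t)
    (F' := fun z (t : ℝ) => ((t : ℂ) ^ (z - 1) * Complex.log (t : ℂ)) • f t)
    (bound := fun t : ℝ => δ⁻¹ * ‖(t : ℂ) ^ (σ - 1) • f t‖) (Metric.ball_mem_nhds s hδ)
    (Eventually.of_forall (aestronglyMeasurable_cpow_smul hσ))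
    (mellinConvergent_of_re_le hf hσ h.le) ?_ ?_ (hσ.norm.const_mul _) ?_).2.differentiableAt
  · refine (hlog.aestronglyMeasurable.smul (aestronglyMeasurable_cpow_smul hσ s)).congr
      (Eventually.of_forall fun t => ?_)
    rw [Pi.smul_apply', smul_smul, mul_comm]
  · filter_upwards [ae_restrict_mem measurableSet_Ioi] with t ht z hz
    rcases lt_or_ge 1 t with h1 | h1
    · simp [hf t h1]
    · have hre : |z.re - s.re| < δ :=
        (Complex.abs_re_le_norm (z - s)).trans_lt (mem_ball_iff_norm.1 hz)
      rw [norm_smul, norm_smul, ← mul_assoc]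
      gcongr
      exact norm_cpow_mul_log_le ht h1 hδ (by linarith [(abs_lt.1 hre).1])
  · filter_upwards [ae_restrict_mem measurableSet_Ioi] with t ht z _
    have ht0 : (t : ℂ) ≠ 0 := by exact_mod_cast (ne_of_gt ht : t ≠ 0)
    have hpow := ((hasDerivAt_id z).sub_const 1).const_cpow (c := (t : ℂ)) (Or.inl ht0)
    rw [mul_one] at hpow
    exact hpow.smul_const (f t)

end UnitSupport

/-! ### The transform of `L²(0, 1)` consists of boundary functions -/

theorem mellinConvergent_indicator_Ioo (f : L2One) {s : ℂ} (hs : 1 / 2 < s.re) :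
    MellinConvergent ((Ioo 0 1).indicator f) s := by
  have ha : -1 / 2 < (s - 1).re := by
    rw [Complex.sub_re, Complex.one_re]
    linarith
  refine ((memLp_lowPow ha 1).integrable_mul (memLp_extend f)).congr
    (Eventually.of_forall fun t => ?_)
  by_cases ht : t ∈ Ioo (0 : ℝ) 1
  · simp [ht, Ioo_subset_Ioc_self ht]
  · simp [ht]

/-- The modified Mellin transform of `f ∈ L²(0, 1)` at the points of the right half plane, i.e. the
analytic function of which `mellinIso (extendZero f)` is the boundary function. -/
def mellinExt (f : L2One) : ℂ → ℂ := modMellin ((Ioo 0 1).indicator f)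

theorem differentiableOn_mellinExt (f : L2One) :
    DifferentiableOn ℂ (mellinExt f) {z | 0 < z.re} := by
  intro z hz
  have hz : 0 < z.re := hz
  have hσ : 1 / 2 < (z / 2 + 1 / 2).re := by
    norm_num
    linarith
  have hlt : (z / 2 + 1 / 2).re < (z + 1 / 2).re := by
    norm_num
    linarith
  have hd : DifferentiableAt ℂ (mellin ((Ioo 0 1).indicator f)) (z + 1 / 2) :=
    differentiableAt_mellin (fun t ht => indicator_of_notMem (fun h => h.2.not_gt ht) _)
      (mellinConvergent_indicator_Ioo f hσ) hlt
  exact ((differentiableAt_comp_add_const.2 hd).const_mul _).differentiableWithinAt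

theorem modMellin_cpow_smul (f : ℝ → ℂ) (a s : ℂ) :
    modMellin (fun t => (t : ℂ) ^ a • f t) s = modMellin f (s + a) := by
  rw [modMellin, modMellin, mellin_cpow_smul, add_right_comm]

theorem eLpNorm_cpow_smul_indicator_Ioo_le (f : ℝ → ℂ) {a : ℂ} (ha : 0 ≤ a.re) :
    eLpNorm (fun t : ℝ => (t : ℂ) ^ a • (Ioo 0 1).indicator f t) 2 (volume.restrict (Ioi 0)) ≤
      eLpNorm f 2 (volume.restrict (Ioo 0 1)) := by
  rw [← eLpNorm_extend]
  refine eLpNorm_mono fun t => ?_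
  by_cases ht : t ∈ Ioo (0 : ℝ) 1
  · rw [norm_smul, Complex.norm_cpow_eq_rpow_re_of_pos ht.1]
    exact mul_le_of_le_one_left (norm_nonneg _) (Real.rpow_le_one ht.1.le ht.2.le ha)
  · simp [ht]

theorem memLp_cpow_smul_indicator_Ioo (f : L2One) {a : ℂ} (ha : 0 ≤ a.re) :
    MemLp (fun t : ℝ => (t : ℂ) ^ a • (Ioo 0 1).indicator f t) 2 (volume.restrict (Ioi 0)) :=
  ⟨(Complex.measurable_ofReal.pow_const a).aestronglyMeasurable.smul (memLp_extend f).1,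
    (eLpNorm_cpow_smul_indicator_Ioo_le f ha).trans_lt (Lp.memLp f).2⟩

theorem eLpNorm_mellinExt_le (f : L2One) {x : ℝ} (hx : 0 < x) :
    eLpNorm (fun y : ℝ => mellinExt f ((x : ℂ) + (y : ℂ) * Complex.I)) 2 volume ≤
      eLpNorm f 2 (volume.restrict (Ioo 0 1)) := by
  have hmem := memLp_cpow_smul_indicator_Ioo f (a := x) hx.le
  have hconv : MellinConvergent (fun t => (t : ℂ) ^ (x : ℂ) • (Ioo 0 1).indicator f t) (1 / 2) :=
    MellinConvergent.cpow_smul.2 (mellinConvergent_indicator_Ioo f (by simpa using hx))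
  have hline : (fun y : ℝ => mellinExt f ((x : ℂ) + (y : ℂ) * Complex.I)) =ᵐ[volume]
      fun y : ℝ => mellinIso (hmem.toLp _) ((y : ℂ) * Complex.I) := by
    filter_upwards [ae_imagAxis_iff.1 (mellinIso_ae_eq hmem.coeFn_toLp hconv)] with y hy
    rw [hy, modMellin_cpow_smul, mellinExt, add_comm]
  calc eLpNorm (fun y : ℝ => mellinExt f ((x : ℂ) + (y : ℂ) * Complex.I)) 2 volume
      = eLpNorm (mellinIso (hmem.toLp _)) 2 imagAxis := by
        rw [eLpNorm_congr_ae hline]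
        exact eLpNorm_comp_measurePreserving (Lp.aestronglyMeasurable _) measurePreserving_toImag
    _ = eLpNorm (fun t : ℝ => (t : ℂ) ^ (x : ℂ) • (Ioo 0 1).indicator f t) 2
          (volume.restrict (Ioi 0)) := by
        rw [← Lp.enorm_def, ← ofReal_norm, mellinIso.norm_map, ofReal_norm, Lp.enorm_toLp]
    _ ≤ eLpNorm f 2 (volume.restrict (Ioo 0 1)) :=
        eLpNorm_cpow_smul_indicator_Ioo_le f hx.le

theorem isHardyFunction_mellinExt (f : L2One) : IsHardyFunction (mellinExt f) := by
  refine ⟨differentiableOn_mellinExt f, ?_⟩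
  refine lt_of_le_of_lt (iSup₂_le fun x hx => ?_)
    (ENNReal.pow_lt_top (n := 2) (Lp.memLp f).2)
  have h := pow_le_pow_left' (eLpNorm_mellinExt_le f hx) 2
  rw [eLpNorm_two_eq_lintegral volume, ← ENNReal.rpow_natCast, ← ENNReal.rpow_mul] at h
  simpa using h

/-- The element of `L²(0, ∞)` whose modified Mellin transform is a multiple of the Poisson kernel
of the right half plane at `z`: a combination of the reproducing kernels for `z` and for its
mirror image `-z̄`. -/
def poissonSource (z : ℂ) (hz : 0 < z.re) : L2Inf :=
  lowPow (starRingEnd ℂ z - 1 / 2) (by norm_num; linarith) 1 +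
    highPow (-z - 1 / 2) (by norm_num; linarith) 1 one_pos

theorem inv_add_conj_sub_inv_sub {z : ℂ} (hz : 0 < z.re) (y : ℝ) :
    ((y : ℂ) * Complex.I + starRingEnd ℂ z)⁻¹ - ((y : ℂ) * Complex.I - z)⁻¹ =
      2 * ((z.re / (z.re ^ 2 + (y - z.im) ^ 2) : ℝ) : ℂ) := by
  have hplus : (z.re : ℂ) + ((y - z.im : ℝ) : ℂ) * Complex.I ≠ 0 := fun h =>
    hz.ne' (by simpa using congrArg Complex.re h)
  have hminus : (z.re : ℂ) - ((y - z.im : ℝ) : ℂ) * Complex.I ≠ 0 := fun h =>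
    hz.ne' (by simpa using congrArg Complex.re h)
  have hmul : ((z.re ^ 2 + (y - z.im) ^ 2 : ℝ) : ℂ) =
      (z.re + ((y - z.im : ℝ) : ℂ) * Complex.I) * (z.re - ((y - z.im : ℝ) : ℂ) * Complex.I) := by
    push_cast
    linear_combination ((y : ℂ) - z.im) ^ 2 * Complex.I_sq
  have hconj : (y : ℂ) * Complex.I + starRingEnd ℂ z =
      z.re + ((y - z.im : ℝ) : ℂ) * Complex.I := by
    apply Complex.ext <;> simp [sub_eq_add_neg]
  have hmirror : (y : ℂ) * Complex.I - z = -(z.re - ((y - z.im : ℝ) : ℂ) * Complex.I) := by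
    apply Complex.ext <;> simp
  rw [hconj, hmirror, Complex.ofReal_div, hmul]
  field_simp
  ring

theorem mellinIso_poissonSource {z : ℂ} (hz : 0 < z.re) :
    ∀ᵐ y : ℝ, mellinIso (poissonSource z hz) ((y : ℂ) * Complex.I) =
      ((√(2 * Real.pi) : ℝ) : ℂ)⁻¹ * (2 * ((z.re / (z.re ^ 2 + (y - z.im) ^ 2) : ℝ) : ℂ)) := by
  rw [poissonSource, map_add]
  filter_upwards [ae_imagAxis_iff.1 (Lp.coeFn_add (mellinIso (lowPow _ _ 1))
      (mellinIso (highPow _ _ 1 one_pos))),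
    ae_imagAxis_iff.1 (mellinIso_lowPow _ one_pos),
    ae_imagAxis_iff.1 (mellinIso_highPow _ one_pos)] with y hadd hlow hhigh
  rw [hadd, Pi.add_apply, hlow, hhigh, ← inv_add_conj_sub_inv_sub hz, Complex.ofReal_one,
    Complex.one_cpow, Complex.one_cpow, one_div, one_div]
  ring_nf

theorem inner_poissonSource {z : ℂ} (hz : 0 < z.re) (f : L2One) :
    inner ℂ (poissonSource z hz) (extendZero f) = mellin ((Ioo 0 1).indicator f) (z + 1 / 2) := by
  have hext : ∀ᵐ t : ℝ, t ∈ Ioi 0 → extendZero f t = (Ioo 0 1).indicator f t :=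
    (ae_restrict_iff' measurableSet_Ioi).1 (extendZero_ae_eq f)
  have hlow : ∫ t in Ioc (0 : ℝ) 1, starRingEnd ℂ ((t : ℂ) ^ (starRingEnd ℂ z - 1 / 2)) *
      extendZero f t = mellin ((Ioo 0 1).indicator f) (z + 1 / 2) := by
    rw [mellin, setIntegral_eq_of_subset_of_forall_sdiff_eq_zero measurableSet_Ioi
      (Ioc_subset_Ioi_self : Ioc (0 : ℝ) 1 ⊆ Ioi 0) fun t ht => by
        rw [indicator_of_notMem fun h => ht.2 (Ioo_subset_Ioc_self h), smul_zero]]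
    refine setIntegral_congr_ae measurableSet_Ioc ?_
    filter_upwards [hext] with t ht hmem
    rw [ht hmem.1, conj_cpow_of_pos hmem.1, smul_eq_mul, map_sub, Complex.conj_conj, map_div₀,
      map_one, map_ofNat]
    ring_nf
  have hhigh : ∫ t in Ioi (1 : ℝ), starRingEnd ℂ ((t : ℂ) ^ (-z - 1 / 2)) * extendZero f t = 0 := by
    refine setIntegral_eq_zero_of_ae_eq_zero ?_
    filter_upwards [hext] with t ht hmem
    rw [ht (Ioi_subset_Ioi zero_le_one hmem), indicator_of_notMem fun h => h.2.not_gt hmem,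
      mul_zero]
  rw [poissonSource, inner_add_left, inner_lowPow, inner_highPow, hlow, hhigh, add_zero]

theorem mellinExt_eq_poisson (f : L2One) {z : ℂ} (hz : 0 < z.re) :
    mellinExt f z = Real.pi⁻¹ • ∫ y : ℝ, (z.re / (z.re ^ 2 + (y - z.im) ^ 2)) •
      mellinIso (extendZero f) ((y : ℂ) * Complex.I) := by
  have hpi : ((√(2 * Real.pi) : ℝ) : ℂ)⁻¹ * (((√(2 * Real.pi) : ℝ) : ℂ)⁻¹ * 2) =
      (Real.pi⁻¹ : ℝ) := by
    rw [← mul_assoc, ← mul_inv, ← Complex.ofReal_mul, Real.mul_self_sqrt (by positivity)]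
    push_cast
    field_simp
  rw [mellinExt, modMellin, ← inner_poissonSource hz, ← mellinIso.inner_map_map, L2.inner_def,
    integral_imagAxis, ← integral_const_mul, ← integral_smul]
  refine integral_congr_ae ?_
  filter_upwards [mellinIso_poissonSource hz] with y hy
  rw [hy, RCLike.inner_apply, map_mul, map_mul, map_inv₀, Complex.conj_ofReal, map_ofNat,
    Complex.conj_ofReal, Complex.real_smul, Complex.real_smul, ← hpi]
  ring

theorem mellinIso_extendZero_mem_hardyPlus (f : L2One) :
    mellinIso (extendZero f) ∈ hardyPlus := by
  refine ⟨mellinExt f, isHardyFunction_mellinExt f, ae_imagAxis_iff.2 ?_⟩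
  have hg : MemLp (fun y : ℝ => mellinIso (extendZero f) ((y : ℂ) * Complex.I)) 2 volume :=
    (Lp.memLp _).comp_measurePreserving measurePreserving_toImag
  filter_upwards [ae_tendsto_poisson hg] with β hβ
  refine hβ.congr' ?_
  filter_upwards [self_mem_nhdsWithin] with x hx
  have hz : 0 < ((x : ℂ) + (β : ℂ) * Complex.I).re := by simpa using hx
  simp [mellinExt_eq_poisson f hz]

/-- The modified Mellin transform as a unitary operator from `L²(0, 1)` onto `H²₊(iℝ)`. -/
def mellinUnitIso : L2One ≃ₗᵢ[ℂ] hardyPlus :=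
  LinearIsometryEquiv.ofSurjective
    { toLinearMap := (mellinIso.toLinearIsometry.comp extendZero).toLinearMap.codRestrict
        hardyPlus mellinIso_extendZero_mem_hardyPlus
      norm_map' := (mellinIso.toLinearIsometry.comp extendZero).norm_map }
    fun g => (exists_mellinIso_extendZero_eq g.2).imp fun _ hf => Subtype.ext hf

theorem coe_mellinUnitIso (f : L2One) :
    (mellinUnitIso f : L2Imag) = mellinIso (extendZero f) := rfl

end HardyMellin

end

theorem proposition3p5 :
    ∃ Q : HardyMellin.L2Inf ≃ₗᵢ[ℂ] HardyMellin.L2Imag,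
      -- `Q` is the modified Mellin transform
      (∀ f, HardyMellin.IsMellinTransform f (Q f)) ∧
      -- `Q` carries `I - H_∞^*` on `L²(0, ∞)` to `M_φ` on `L²(iℝ)`
      (∀ f, Q (f - ContinuousLinearMap.adjoint HardyMellin.hardyInf f) =
        HardyMellin.mulPhi (Q f)) ∧
      -- `L²(0, 1)` is invariant for `I - H_∞^*`, and the restriction is `I - H_1^*`
      (∀ f : HardyMellin.L2One,
        HardyMellin.extendZero f -
            ContinuousLinearMap.adjoint HardyMellin.hardyInf (HardyMellin.extendZero f) =
          HardyMellin.extendZero (f - ContinuousLinearMap.adjoint HardyMellin.hardyOne f)) ∧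
      -- `H²₊(iℝ)` is invariant for `M_φ`
      (∀ g ∈ HardyMellin.hardyPlus, HardyMellin.mulPhi g ∈ HardyMellin.hardyPlus) ∧
      -- `Q` restricts to a unitary `L²(0, 1) → H²₊(iℝ)` carrying `I - H_1^*` to `M_φ`
      (∃ U : HardyMellin.L2One ≃ₗᵢ[ℂ] HardyMellin.hardyPlus,
        (∀ f, (U f : HardyMellin.L2Imag) = Q (HardyMellin.extendZero f)) ∧
        (∀ f, (U (f - ContinuousLinearMap.adjoint HardyMellin.hardyOne f) :
            HardyMellin.L2Imag) = HardyMellin.mulPhi (U f))) ∧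
      -- `I - H_∞` on `L²(0, ∞)` is carried to `M_φ` on `L²(iℝ)` by `f ↦ (s ↦ (Q f)(-s))`
      (∃ V : HardyMellin.L2Inf ≃ₗᵢ[ℂ] HardyMellin.L2Imag,
        (∀ f, ∀ᵐ s ∂HardyMellin.imagAxis, V f s = Q f (-s)) ∧
        (∀ f, V (f - HardyMellin.hardyInf f) = HardyMellin.mulPhi (V f))) := by
  refine ⟨HardyMellin.mellinIso, HardyMellin.isMellinTransform_mellinIso,
    HardyMellin.mellinIso_sub_adjoint_hardyInf, HardyMellin.extendZero_sub_adjoint_hardyInf,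
    fun g hg => HardyMellin.mulPhi_mem_hardyPlus hg,
    ⟨HardyMellin.mellinUnitIso, HardyMellin.coe_mellinUnitIso, fun f => ?_⟩,
    ⟨HardyMellin.mellinReflIso, HardyMellin.mellinReflIso_ae,
      HardyMellin.mellinReflIso_sub_hardyInf⟩⟩
  rw [HardyMellin.coe_mellinUnitIso, HardyMellin.coe_mellinUnitIso,
    ← HardyMellin.extendZero_sub_adjoint_hardyInf, HardyMellin.mellinIso_sub_adjoint_hardyInf]
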